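/- All algebras are unital associative algebras over $\mathbb C$, $\otimes=\otimes_{\mathbb C}$, ideals are two-sided. **Differential algebras.** A differential algebra is an $\mathbb N$-graded algebra $\Gamma=\bigoplus_n\Gamma^n$ with a linear $d:\Gamma^n\to\Gamma^{n+1}$, $d^2=0$, satisfying the graded Leibniz rule; homomorphisms respect the product, the grading and $d$; differential ideals are graded $d$-invariant ideals. It is a differential algebra over $A$ if $\Gamma^0=A$, and a differential calculus $\Gamma(A)$ if moreover it is generated as an algebra by $A$ and the $da$, $a\in A$. $\Omega(A)$ denotes the universal differential calculus, $\hat\otimes$ the graded (skew) tensor product. A finite family of ideals $(K_i)_{i\in I}$ of $A$ is a covering if $\bigcap_iK_i=0$; its covering completion is $\{(a_i)_i\in\bigoplus_iA/K_i : a_i=a_j \text{ in } A/(K_i+K_j)\ \forall i,j\}$ (the same for differential ideals of a differential algebra), and the covering is complete if $A$ maps onto the completion. An LC-differential algebra over $A$ is a differential algebra $\Gamma$ over $A$ with a covering $(K_i)_{i\in I}$ by differential ideals such that each $\Gamma/K_i$ is a differential calculus over $A/K_i^0$ and $K_i^0:=K_i\cap A\neq0$; the $\Gamma/K_i$ are its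 local differential calculi. **The bundle.** Let $I$ be finite, $(J_i)_{i\in I}$ a complete covering of $B$ with $J_i\ne0$ for all $i$, $B_i=B/J_i$, $B_{ij}=B/(J_i+J_j)$, with projections $\pi_i:B\to B_i$, $\pi^i_j:B_i\to B_{ij}$. Let $H$ be a Hopf algebra, $P$ a right $H$-comodule algebra with coaction $\Delta_P$, $\iota:B\to P$ an injective homomorphism with image $\{p:\Delta_P(p)=p\otimes1\}$, and $\chi_i:P\to B_i\otimes H$ surjective homomorphisms with $(\mathrm{id}\otimes\Delta)\chi_i=(\chi_i\otimes \mathrm{id})\Delta_P$, $\chi_i(\iota(b))=\pi_i(b)\otimes1$, such that $(\ker\chi_i)_i$ is a complete covering of $P$ (a locally trivial quantum principal fibre bundle). **Its differential structure.** Let differential calculi $\Gamma(B_i)$ and a right covariant differential calculus $\Gamma(H)$ be given. Let $\chi_{i,\Omega\to\Gamma}:\Omega(P)\to\Gamma(B_i)\hat\otimes\Gamma(H)$ be the extension of $\chi_i$, $\Gamma(P)=\Omega(P)/\bigcap_i\ker\chi_{i,\Omega\to\Gamma}$, $\chi_{i\Gamma}:\Gamma(P)\to\Gamma(B_i)\hat\otimes\Gamma(H)$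 the induced surjection, and $\Gamma_c(P)$ the covering completion of $\Gamma(P)$ with respect to $(\ker\chi_{i\Gamma})_i$, with $\chi_{i\Gamma_c}:\Gamma_c(P)\to\Gamma(P)/\ker\chi_{i\Gamma}\cong\Gamma(B_i)\hat\otimes\Gamma(H)$ the $i$-th projection. **The algebra $\Gamma_m(B)$.** Put $\Gamma^i(B_{ij}\otimes H)=(\Gamma(B_i)\hat\otimes\Gamma(H))/\chi_{i\Gamma}(\ker\chi_{j\Gamma})$. Let $J^i(B_{ij}\otimes H)$ be the kernel of the homomorphism of differential algebras $\Omega(B_{ij}\otimes H)\to\Gamma^i(B_{ij}\otimes H)$ that extends $b\otimes h\mapsto[\tilde b\otimes h]$, where $\tilde b\in B_i$ is any lift of $b$, let $J_m(B_{ij})$ be its preimage in $\Omega(B_{ij})$ under the map induced by $b\mapsto b\otimes1$, and $\Gamma_m(B_{ij})=\Omega(B_{ij})/J_m(B_{ij})$. The projections $\pi^i_j,\pi^j_i$ extend to homomorphisms $\pi^i_{j\Gamma_m}:\Gamma(B_i)\to\Gamma_m(B_{ij})$ and $\pi^j_{i\Gamma_m}:\Gamma(B_j)\to\Gamma_m(B_{ij})$.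 Define $$\Gamma_m(B)=\Big\{(\gamma_i)_{i\in I}\in\bigoplus_{i\in I}\Gamma(B_i) : \pi^i_{j\Gamma_m}(\gamma_i)=\pi^j_{i\Gamma_m}(\gamma_j)\ \forall i,j\Big\},\qquad B\to\Gamma_m(B),\ b\mapsto(\pi_i(b))_i .$$ **Embeddability.** An LC-differential algebra $\Gamma_g(B)$ over $B$ is embeddable into $\Gamma_c(P)$ if its local differential calculi are the $\Gamma(B_i)$, i.e. it comes with surjective homomorphisms of differential algebras $\pi_{i\Gamma_g}:\Gamma_g(B)\to\Gamma(B_i)$ extending $\pi_i$ whose kernels are its covering ideals, and if there is a homomorphism of differential algebras $\iota_{\Gamma_g}:\Gamma_g(B)\to\Gamma_c(P)$ extending $\iota$ with $$\chi_{i\Gamma_c}(\iota_{\Gamma_g}(\gamma))=\pi_{i\Gamma_g}(\gamma)\,\hat\otimes\,1\qquad\forall\gamma\in\Gamma_g(B),\ i\in I.$$ **Proposition.** $\Gamma_m(B)$, with the coordinate projections $\Gamma_m(B)\to\Gamma(B_i)$, is an LC-differential algebra over $B$ which is embeddable into $\Gamma_c(P)$, and it is the maximal one: for every LC-differential algebra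 $\Gamma_g(B)$ over $B$ which is embeddable into $\Gamma_c(P)$, $\gamma\mapsto(\pi_{i\Gamma_g}(\gamma))_{i\in I}$ is an injective homomorphism of differential algebras $\Gamma_g(B)\to\Gamma_m(B)$ which is the identity on $B$. -/

import Mathlib

open scoped TensorProduct DirectSum

noncomputable section

/-- A differential algebra over `ℂ`: a unital associative `ℕ`-graded algebra `Γ = ⨁ₙ Γⁿ` with a
graded derivation `d` of degree one such that `d² = 0`. -/
structure DiffAlg where
  carrier : Type*
  [ring : Ring carrier]
  [algebra : Algebra ℂ carrier]
  deg : ℕ → Submodule ℂ carrier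
  internal : DirectSum.IsInternal deg
  one_mem : (1 : carrier) ∈ deg 0
  mul_mem : ∀ {m n : ℕ} {x y : carrier}, x ∈ deg m → y ∈ deg n → x * y ∈ deg (m + n)
  d : carrier →ₗ[ℂ] carrier
  d_mem : ∀ {n : ℕ} {x : carrier}, x ∈ deg n → d x ∈ deg (n + 1)
  leibniz : ∀ {n : ℕ} {x : carrier}, x ∈ deg n → ∀ y : carrier,
    d (x * y) = d x * y + (-1 : ℂ) ^ n • (x * d y)
  d_d : ∀ x : carrier, d (d x) = 0

namespace DiffAlg

instance : CoeSort DiffAlg (Type _) := ⟨DiffAlg.carrier⟩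

attribute [instance] DiffAlg.ring DiffAlg.algebra

/-- A criterion for a family of submodules to be an internal direct sum. -/
theorem isInternal_of_proj {M : Type*} [AddCommGroup M] [Module ℂ M] (deg : ℕ → Submodule ℂ M)
    (pr : ℕ → M →ₗ[ℂ] M) (h : ∀ m n x, x ∈ deg n → pr m x = if m = n then x else 0)
    (hs : ⨆ n, deg n = ⊤) : DirectSum.IsInternal deg := by
  classical
  have key : ∀ (m : ℕ) (x : ⨁ n, deg n),
      pr m (DirectSum.coeAddMonoidHom deg x) = (x m : M) := by
    intro m x
    induction x using DirectSum.induction_on with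
    | zero => simp
    | of i x =>
      rw [DirectSum.coeAddMonoidHom_of, h m i _ x.2]
      by_cases hm : m = i
      · subst hm; simp
      · rw [if_neg hm, DirectSum.of_eq_of_ne _ _ _ hm]; rfl
    | add x y hx hy => simp [hx, hy]
  constructor
  · rw [injective_iff_map_eq_zero]
    intro x hx
    ext m
    rw [← key m x, hx]; simp
  · intro y
    have hy : y ∈ ⨆ n, deg n := hs ▸ Submodule.mem_top
    induction hy using Submodule.iSup_induction' with
    | mem i x hx => exact ⟨DirectSum.of (fun n => deg n) i ⟨x, hx⟩, DirectSum.coeAddMonoidHom_of ..⟩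
    | zero => exact ⟨0, map_zero _⟩
    | add x y _ _ hx hy =>
      obtain ⟨a, rfl⟩ := hx
      obtain ⟨b, rfl⟩ := hy
      exact ⟨a + b, map_add _ _ _⟩

instance (Γ : DiffAlg) : SetLike.GradedMonoid Γ.deg where
  one_mem := Γ.one_mem
  mul_mem _ _ _ _ := Γ.mul_mem

instance (Γ : DiffAlg) : DirectSum.Decomposition Γ.deg := Γ.internal.chooseDecomposition

instance (Γ : DiffAlg) : GradedAlgebra Γ.deg where

/-- The projection onto the component of degree `n`. -/
def proj (Γ : DiffAlg) (n : ℕ) : Γ →ₗ[ℂ] Γ := GradedAlgebra.proj Γ.deg n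

theorem proj_of_mem (Γ : DiffAlg) (m n : ℕ) (x : Γ) (hx : x ∈ Γ.deg n) :
    Γ.proj m x = if m = n then x else 0 := by
  rw [proj, GradedAlgebra.proj_apply]
  by_cases h : m = n
  · subst h; rw [if_pos rfl, DirectSum.decompose_of_mem_same _ hx]
  · rw [if_neg h, DirectSum.decompose_of_mem_ne _ hx (Ne.symm h)]

theorem proj_mem (Γ : DiffAlg) (n : ℕ) (x : Γ) : Γ.proj n x ∈ Γ.deg n := by
  rw [proj, GradedAlgebra.proj_apply]; exact SetLike.coe_mem _

theorem iSup_deg (Γ : DiffAlg) : ⨆ n, Γ.deg n = ⊤ := Γ.internal.submodule_iSup_eq_top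

theorem exists_sum_proj (Γ : DiffAlg) (x : Γ) : ∃ s : Finset ℕ, ∀ t : Finset ℕ, s ⊆ t →
    ∑ n ∈ t, Γ.proj n x = x := by
  classical
  refine ⟨(DirectSum.decompose Γ.deg x).support, fun t ht => ?_⟩
  rw [← Finset.sum_subset ht]
  · exact DirectSum.sum_support_decompose Γ.deg x
  · intro n _ hn
    rw [DFinsupp.notMem_support_iff] at hn
    rw [proj, GradedAlgebra.proj_apply, hn]; rfl

/-- Induction on homogeneous elements. -/
theorem hom_induction (Γ : DiffAlg) {p : Γ → Prop} (x : Γ)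
    (hom : ∀ n, ∀ y ∈ Γ.deg n, p y) (zero : p 0) (add : ∀ y z, p y → p z → p (y + z)) : p x := by
  have hx : x ∈ ⨆ n, Γ.deg n := Γ.iSup_deg ▸ Submodule.mem_top
  induction hx using Submodule.iSup_induction' with
  | mem i x hx => exact hom i x hx
  | zero => exact zero
  | add x y _ _ hx hy => exact add _ _ hx hy

/-! ### Homomorphisms of differential algebras -/

/-- Homomorphisms of differential algebras: algebra homomorphisms which respect the grading and
commute with the differentials. -/
structure Hom (Γ Λ : DiffAlg) extends Γ.carrier →ₐ[ℂ] Λ.carrier where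
  map_deg : ∀ {n : ℕ} {x : Γ}, x ∈ Γ.deg n → toFun x ∈ Λ.deg n
  map_d : ∀ x : Γ, toFun (Γ.d x) = Λ.d (toFun x)

namespace Hom

variable {Γ Λ Θ : DiffAlg}

instance : CoeFun (Hom Γ Λ) fun _ => Γ → Λ := ⟨fun f => f.toAlgHom⟩

theorem map_mem (f : Hom Γ Λ) {n : ℕ} {x : Γ} (hx : x ∈ Γ.deg n) : f x ∈ Λ.deg n := f.map_deg hx

theorem comm_d (f : Hom Γ Λ) (x : Γ) : f (Γ.d x) = Λ.d (f x) := f.map_d x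

theorem map_proj (f : Hom Γ Λ) (n : ℕ) (x : Γ) : f (Γ.proj n x) = Λ.proj n (f x) := by
  induction x using Γ.hom_induction with
  | hom m y hy =>
    rw [Γ.proj_of_mem n m y hy, Λ.proj_of_mem n m _ (f.map_mem hy)]
    split_ifs <;> simp
  | zero => simp
  | add y z hy hz => simp [hy, hz]

/-- Composition of homomorphisms of differential algebras. -/
def comp (g : Hom Λ Θ) (f : Hom Γ Λ) : Hom Γ Θ where
  toAlgHom := g.toAlgHom.comp f.toAlgHom
  map_deg hx := g.map_mem (f.map_mem hx)
  map_d x := by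
    change g (f (Γ.d x)) = Θ.d (g (f x))
    rw [f.comm_d, g.comm_d]

@[simp] theorem comp_apply (g : Hom Λ Θ) (f : Hom Γ Λ) (x : Γ) : g.comp f x = g (f x) := rfl

end Hom

/-! ### Differential ideals and quotients -/

/-- Differential ideals: two-sided ideals which are graded and `d`-invariant. -/
structure DiffIdeal (Γ : DiffAlg) where
  ideal : Ideal Γ
  twoSided : ideal.IsTwoSided
  graded : ∀ (n : ℕ) {x : Γ}, x ∈ ideal → Γ.proj n x ∈ ideal
  d_mem : ∀ {x : Γ}, x ∈ ideal → Γ.d x ∈ ideal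

attribute [instance] DiffIdeal.twoSided

namespace DiffIdeal

variable {Γ Λ : DiffAlg}

/-- The preimage of a differential ideal under a homomorphism. -/
def comap (f : Hom Γ Λ) (J : DiffIdeal Λ) : DiffIdeal Γ where
  ideal := J.ideal.comap f.toAlgHom
  twoSided := inferInstance
  graded n x hx := by
    change f (Γ.proj n x) ∈ J.ideal
    rw [f.map_proj]
    exact J.graded n hx
  d_mem {x} hx := by
    change f (Γ.d x) ∈ J.ideal
    rw [f.comm_d]
    exact J.d_mem hx

/-- The kernel of a homomorphism of differential algebras. -/
def ker (f : Hom Γ Λ) : DiffIdeal Γ where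
  ideal := RingHom.ker f.toAlgHom
  twoSided := inferInstance
  graded n x hx := by
    change f (Γ.proj n x) = 0
    have hx : f x = 0 := hx
    rw [f.map_proj, hx, map_zero]
  d_mem {x} hx := by
    change f (Γ.d x) = 0
    have hx : f x = 0 := hx
    rw [f.comm_d, hx, map_zero]

/-- The intersection of a family of differential ideals. -/
def inf {I : Type*} (K : I → DiffIdeal Γ) : DiffIdeal Γ where
  ideal := ⨅ i, (K i).ideal
  twoSided := inferInstance
  graded n x hx := by
    rw [Submodule.mem_iInf] at hx ⊢
    exact fun i => (K i).graded n (hx i)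
  d_mem {x} hx := by
    rw [Submodule.mem_iInf] at hx ⊢
    exact fun i => (K i).d_mem (hx i)

/-- The sum of two-sided ideals is two-sided. -/
theorem sup_isTwoSided {A : Type*} [Ring A] (J K : Ideal A) [J.IsTwoSided] [K.IsTwoSided] :
    (J ⊔ K).IsTwoSided := by
  refine ⟨fun b ha => ?_⟩
  obtain ⟨x, hx, y, hy, rfl⟩ := Submodule.mem_sup.mp ha
  rw [add_mul]
  exact Submodule.add_mem_sup (J.mul_mem_right b hx) (K.mul_mem_right b hy)

/-- The sum of two differential ideals. -/
def sup (J K : DiffIdeal Γ) : DiffIdeal Γ where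
  ideal := J.ideal ⊔ K.ideal
  twoSided := sup_isTwoSided _ _
  graded n x hx := by
    obtain ⟨x, hx', y, hy, rfl⟩ := Submodule.mem_sup.mp hx
    rw [map_add]
    exact Submodule.add_mem_sup (J.graded n hx') (K.graded n hy)
  d_mem {x} hx := by
    obtain ⟨x, hx', y, hy, rfl⟩ := Submodule.mem_sup.mp hx
    rw [map_add]
    exact Submodule.add_mem_sup (J.d_mem hx') (K.d_mem hy)

/-- The image of a differential ideal under a surjective homomorphism. -/
def map (f : Hom Γ Λ) (hf : Function.Surjective f) (J : DiffIdeal Γ) : DiffIdeal Λ where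
  ideal := J.ideal.map f.toAlgHom
  twoSided := by
    refine ⟨fun b ha => ?_⟩
    obtain ⟨x, hx, rfl⟩ := (Ideal.mem_map_iff_of_surjective f.toAlgHom hf).mp ha
    obtain ⟨y, rfl⟩ := hf b
    rw [← map_mul]
    exact Ideal.mem_map_of_mem _ (J.ideal.mul_mem_right y hx)
  graded n x hx := by
    obtain ⟨x, hx', rfl⟩ := (Ideal.mem_map_iff_of_surjective f.toAlgHom hf).mp hx
    rw [← f.map_proj]
    exact Ideal.mem_map_of_mem _ (J.graded n hx')
  d_mem {x} hx := by
    obtain ⟨x, hx', rfl⟩ := (Ideal.mem_map_iff_of_surjective f.toAlgHom hf).mp hx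
    rw [← f.comm_d]
    exact Ideal.mem_map_of_mem _ (J.d_mem hx')

/-- The factor differential algebra `Γ/J`. -/
def quot (J : DiffIdeal Γ) : DiffAlg where
  carrier := Γ.carrier ⧸ J.ideal
  deg n := (Γ.deg n).map (Ideal.Quotient.mkₐ ℂ J.ideal).toLinearMap
  internal := by
    let q := (Ideal.Quotient.mkₐ ℂ J.ideal).toLinearMap
    let pr : ℕ → (Γ.carrier ⧸ J.ideal) →ₗ[ℂ] (Γ.carrier ⧸ J.ideal) := fun n =>
      { toFun := Quotient.lift (fun x => q (Γ.proj n x)) (by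
          intro a b hab
          have hab : a - b ∈ J.ideal := (Submodule.quotientRel_def _).mp hab
          have := J.graded n hab
          rw [map_sub] at this
          exact Ideal.Quotient.eq.mpr this)
        map_add' := by
          rintro ⟨x⟩ ⟨y⟩
          change q (Γ.proj n (x + y)) = q _ + q _
          rw [map_add, map_add]
        map_smul' := by
          rintro c ⟨x⟩
          change q (Γ.proj n (c • x)) = c • q _
          rw [map_smul, map_smul] }
    refine isInternal_of_proj _ pr ?_ ?_
    · rintro m n _ ⟨x, hx, rfl⟩
      change q (Γ.proj m x) = if m = n then q x else 0
      rw [Γ.proj_of_mem m n x hx]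
      split_ifs <;> simp
    · rw [← Submodule.map_iSup, Γ.iSup_deg, Submodule.map_top, LinearMap.range_eq_top]
      exact Ideal.Quotient.mk_surjective
  one_mem := ⟨1, Γ.one_mem, map_one (Ideal.Quotient.mkₐ ℂ J.ideal)⟩
  mul_mem := by
    rintro m n _ _ ⟨x, hx, rfl⟩ ⟨y, hy, rfl⟩
    exact ⟨x * y, Γ.mul_mem hx hy, map_mul (Ideal.Quotient.mkₐ ℂ J.ideal) x y⟩
  d :=
    { toFun := Quotient.lift (fun x => Ideal.Quotient.mkₐ ℂ J.ideal (Γ.d x)) (by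
          intro a b hab
          have hab : a - b ∈ J.ideal := (Submodule.quotientRel_def _).mp hab
          have := J.d_mem hab
          rw [map_sub] at this
          exact Ideal.Quotient.eq.mpr this)
      map_add' := by
          rintro ⟨x⟩ ⟨y⟩
          change Ideal.Quotient.mkₐ ℂ J.ideal (Γ.d (x + y)) = Ideal.Quotient.mkₐ ℂ J.ideal _ +
            Ideal.Quotient.mkₐ ℂ J.ideal _
          rw [map_add, map_add]
      map_smul' := by
          rintro c ⟨x⟩
          change Ideal.Quotient.mkₐ ℂ J.ideal (Γ.d (c • x)) = c • Ideal.Quotient.mkₐ ℂ J.ideal _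
          rw [map_smul, map_smul] }
  d_mem := by
    rintro n _ ⟨x, hx, rfl⟩
    exact ⟨Γ.d x, Γ.d_mem hx, rfl⟩
  leibniz := by
    rintro n _ ⟨x, hx, rfl⟩ ⟨y⟩
    change Ideal.Quotient.mkₐ ℂ J.ideal (Γ.d (x * y)) =
      Ideal.Quotient.mkₐ ℂ J.ideal (Γ.d x) * Ideal.Quotient.mkₐ ℂ J.ideal y +
      (-1 : ℂ) ^ n • (Ideal.Quotient.mkₐ ℂ J.ideal x * Ideal.Quotient.mkₐ ℂ J.ideal (Γ.d y))
    rw [Γ.leibniz hx y, map_add, map_mul, map_smul, map_mul]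
  d_d := by
    rintro ⟨x⟩
    change Ideal.Quotient.mkₐ ℂ J.ideal (Γ.d (Γ.d x)) = 0
    rw [Γ.d_d, map_zero]

/-- The canonical projection `Γ → Γ/J`. -/
def toQuot (J : DiffIdeal Γ) : Hom Γ J.quot where
  toAlgHom := Ideal.Quotient.mkₐ ℂ J.ideal
  map_deg hx := ⟨_, hx, rfl⟩
  map_d _ := rfl

theorem toQuot_surjective (J : DiffIdeal Γ) : Function.Surjective J.toQuot := Ideal.Quotient.mk_surjective

theorem toQuot_eq_zero (J : DiffIdeal Γ) (x : Γ) : J.toQuot x = 0 ↔ x ∈ J.ideal :=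
  Ideal.Quotient.eq_zero_iff_mem

/-- The homomorphism `Γ/J → Λ` induced by a homomorphism `Γ → Λ` which vanishes on `J`. -/
def lift (J : DiffIdeal Γ) (f : Hom Γ Λ) (hf : ∀ x ∈ J.ideal, f x = 0) : Hom J.quot Λ where
  toAlgHom := Ideal.Quotient.liftₐ J.ideal f.toAlgHom hf
  map_deg := by
    rintro n _ ⟨x, hx, rfl⟩
    exact f.map_mem hx
  map_d := by
    rintro ⟨x⟩
    exact f.comm_d x

@[simp] theorem lift_toQuot (J : DiffIdeal Γ) (f : Hom Γ Λ) (hf : ∀ x ∈ J.ideal, f x = 0) (x : Γ) :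
    J.lift f hf (J.toQuot x) = f x := rfl

end DiffIdeal

/-- The homomorphism `Λ → Θ` induced by `f : Γ → Θ`, where `q : Γ → Λ` is surjective and `f`
vanishes on the kernel of `q`. -/
def Hom.factor {Γ Λ Θ : DiffAlg} (q : Hom Γ Λ) (hq : Function.Surjective q) (f : Hom Γ Θ)
    (hf : ∀ x, q x = 0 → f x = 0) : Hom Λ Θ :=
  have key : ∀ x, f (Function.surjInv hq (q x)) = f x := fun x => by
    rw [← sub_eq_zero, ← map_sub]
    apply hf
    rw [map_sub, Function.surjInv_eq hq, sub_self]
  { toFun := fun y => f (Function.surjInv hq y)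
    map_one' := by rw [← map_one q.toAlgHom]; exact (key 1).trans (map_one _)
    map_zero' := by rw [← map_zero q.toAlgHom]; exact (key 0).trans (map_zero _)
    map_mul' := by
      intro y z
      obtain ⟨y, rfl⟩ := hq y
      obtain ⟨z, rfl⟩ := hq z
      rw [← map_mul, key, key, key, map_mul]
    map_add' := by
      intro y z
      obtain ⟨y, rfl⟩ := hq y
      obtain ⟨z, rfl⟩ := hq z
      rw [← map_add, key, key, key, map_add]
    commutes' := by
      intro c
      rw [← q.toAlgHom.commutes c]
      exact (key _).trans (f.toAlgHom.commutes c)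
    map_deg := by
      intro n y hy
      obtain ⟨x, rfl⟩ := hq y
      have h : q x = q (Γ.proj n x) := by
        rw [q.map_proj, Λ.proj_of_mem n n _ hy, if_pos rfl]
      change f (Function.surjInv hq (q x)) ∈ _
      rw [h, key]
      exact f.map_mem (Γ.proj_mem n x)
    map_d := by
      intro y
      obtain ⟨x, rfl⟩ := hq y
      rw [← q.comm_d, key, key, f.comm_d] }

theorem Hom.factor_apply {Γ Λ Θ : DiffAlg} (q : Hom Γ Λ) (hq : Function.Surjective q)
    (f : Hom Γ Θ) (hf : ∀ x, q x = 0 → f x = 0) (x : Γ) : q.factor hq f hf (q x) = f x := by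
  change f (Function.surjInv hq (q x)) = f x
  rw [← sub_eq_zero, ← map_sub]
  apply hf
  rw [map_sub, Function.surjInv_eq hq, sub_self]

/-! ### Gluing -/

section Gluing

variable {I : Type*} [Finite I] (Γ : I → DiffAlg) (Λ : I → I → DiffAlg)
  (p : ∀ i j, Hom (Γ i) (Λ i j)) (q : ∀ i j, Hom (Γ j) (Λ i j))

/-- The algebra `{(γᵢ) ∈ ⨁ᵢ Γᵢ | pᵢⱼ(γᵢ) = qᵢⱼ(γⱼ)}`. -/
def gluingAlgebra : Subalgebra ℂ (∀ i, Γ i) where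
  carrier := {x | ∀ i j, p i j (x i) = q i j (x j)}
  mul_mem' {x y} hx hy i j := by
    change p i j (x i * y i) = q i j (x j * y j)
    rw [map_mul, map_mul, hx i j, hy i j]
  add_mem' {x y} hx hy i j := by
    change p i j (x i + y i) = q i j (x j + y j)
    rw [map_add, map_add, hx i j, hy i j]
  algebraMap_mem' c i j := by
    change p i j (algebraMap ℂ _ c) = q i j (algebraMap ℂ _ c)
    rw [AlgHom.commutes, AlgHom.commutes]

/-- The gluing `{(γᵢ) ∈ ⨁ᵢ Γᵢ | pᵢⱼ(γᵢ) = qᵢⱼ(γⱼ)}` of a finite family of differential algebras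
`Γᵢ` along the differential algebras `Λᵢⱼ` by means of `pᵢⱼ : Γᵢ → Λᵢⱼ` and `qᵢⱼ : Γⱼ → Λᵢⱼ`, with
componentwise grading and differential. -/
def gluing : DiffAlg where
  carrier := gluingAlgebra Γ Λ p q
  deg n :=
    { carrier := {x | ∀ i, x.1 i ∈ (Γ i).deg n}
      add_mem' := fun hx hy i => (Γ i |>.deg n).add_mem (hx i) (hy i)
      zero_mem' := fun i => (Γ i |>.deg n).zero_mem
      smul_mem' := fun c _ hx i => (Γ i |>.deg n).smul_mem c (hx i) }
  internal := by
    classical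
    have := Fintype.ofFinite I
    let pr : ℕ → gluingAlgebra Γ Λ p q →ₗ[ℂ] gluingAlgebra Γ Λ p q := fun n =>
      { toFun := fun x => ⟨fun i => (Γ i).proj n (x.1 i), fun i j => by
          rw [(p i j).map_proj, (q i j).map_proj, x.2 i j]⟩
        map_add' := fun x y => Subtype.ext (funext fun i => map_add ((Γ i).proj n) _ _)
        map_smul' := fun c x => Subtype.ext (funext fun i => map_smul ((Γ i).proj n) _ _) }
    refine isInternal_of_proj _ pr ?_ ?_
    · intro m n x hx
      apply Subtype.ext
      funext i
      change (Γ i).proj m (x.1 i) = _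
      rw [(Γ i).proj_of_mem m n _ (hx i)]
      split_ifs <;> rfl
    · rw [eq_top_iff]
      rintro x -
      choose s hs using fun i => (Γ i).exists_sum_proj (x.1 i)
      have hx : x = ∑ n ∈ Finset.univ.biUnion s, pr n x := by
        apply Subtype.ext
        funext i
        rw [AddSubmonoidClass.coe_finsetSum, Finset.sum_apply]
        exact (hs i _ (Finset.subset_biUnion_of_mem s (Finset.mem_univ i))).symm
      rw [hx]
      exact Submodule.sum_mem _ fun n _ =>
        Submodule.mem_iSup_of_mem n fun i => (Γ i).proj_mem n (x.1 i)
  one_mem i := (Γ i).one_mem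
  mul_mem hx hy i := (Γ i).mul_mem (hx i) (hy i)
  d :=
    { toFun := fun x => ⟨fun i => (Γ i).d (x.1 i), fun i j => by
        rw [(p i j).comm_d, (q i j).comm_d, x.2 i j]⟩
      map_add' := fun x y => Subtype.ext (funext fun i => map_add (Γ i).d _ _)
      map_smul' := fun c x => Subtype.ext (funext fun i => map_smul (Γ i).d _ _) }
  d_mem hx i := (Γ i).d_mem (hx i)
  leibniz hx y := Subtype.ext (funext fun i => (Γ i).leibniz (hx i) (y.1 i))
  d_d x := Subtype.ext (funext fun i => (Γ i).d_d (x.1 i))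

/-- The restriction `(γₖ)ₖ ↦ γᵢ` of the `i`-th projection to the gluing. -/
def gluingProj (i : I) : Hom (gluing Γ Λ p q) (Γ i) where
  toAlgHom := (Pi.evalAlgHom ℂ (fun i => (Γ i).carrier) i).comp (gluingAlgebra Γ Λ p q).val
  map_deg hx := hx i
  map_d _ := rfl

/-- The covering completion of a differential algebra `Γ` with respect to a finite family `(Kᵢ)` of
differential ideals: the gluing of the `Γ/Kᵢ` along the `Γ/(Kᵢ + Kⱼ)` by means of the canonical
projections. -/
def completion (Γ : DiffAlg) (K : I → DiffIdeal Γ) : DiffAlg :=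
  gluing (fun i => (K i).quot) (fun i j => ((K i).sup (K j)).quot)
    (fun i j => (K i).lift ((K i).sup (K j)).toQuot fun x hx =>
      (DiffIdeal.toQuot_eq_zero _ x).mpr (Submodule.mem_sup_left hx))
    (fun i j => (K j).lift ((K i).sup (K j)).toQuot fun x hx =>
      (DiffIdeal.toQuot_eq_zero _ x).mpr (Submodule.mem_sup_right hx))

/-- The `i`-th projection from the covering completion. -/
def completionProj (Γ : DiffAlg) (K : I → DiffIdeal Γ) (i : I) :
    Hom (completion Γ K) (K i).quot :=
  gluingProj _ _ _ _ i

/-- The canonical homomorphism `x ↦ (x + Kᵢ)ᵢ` from `Γ` to its covering completion. -/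
def toCompletion (Γ : DiffAlg) (K : I → DiffIdeal Γ) : Hom Γ (completion Γ K) where
  toFun x := ⟨fun i => (K i).toQuot x, fun _ _ => rfl⟩
  map_one' := rfl
  map_zero' := rfl
  map_mul' _ _ := rfl
  map_add' _ _ := rfl
  commutes' _ := rfl
  map_deg hx i := (K i).toQuot.map_mem hx
  map_d _ := rfl

end Gluing

/-! ### The skew tensor product -/

section Skew

open TensorProduct

variable (Γ Λ : DiffAlg)

/-- The grading operator `γ ↦ (-1)ⁿ γ` for `γ` of degree `n`. -/
def sign : Γ →ₗ[ℂ] Γ :=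
  (DirectSum.toModule ℂ ℕ Γ fun n => (-1 : ℂ) ^ n • (Γ.deg n).subtype) ∘ₗ
    (DirectSum.decomposeLinearEquiv Γ.deg).toLinearMap

theorem sign_of_mem {n : ℕ} {x : Γ} (hx : x ∈ Γ.deg n) : Γ.sign x = (-1 : ℂ) ^ n • x := by
  rw [sign, LinearMap.comp_apply]
  change DirectSum.toModule ℂ ℕ Γ _ (DirectSum.decompose Γ.deg x) = _
  rw [DirectSum.decompose_of_mem _ hx, ← DirectSum.lof_eq_of ℂ, DirectSum.toModule_lof]
  rfl

/-- The underlying algebra of the skew tensor product: the vector space `Γ ⊗ Λ` with the product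
`(γ ⊗ ρ)(ω ⊗ τ) = (-1)ᵐⁿ γω ⊗ ρτ` for `ρ ∈ Λᵐ`, `ω ∈ Γⁿ`. -/
abbrev SkewTensor : Type _ := Γ.deg ᵍ⊗[ℂ] Λ.deg

variable {Γ Λ} in
/-- The element `γ ⊗ ρ` of the skew tensor product. -/
abbrev stmul (x : Γ) (y : Λ) : SkewTensor Γ Λ := GradedTensorProduct.tmul ℂ x y

theorem stmul_mul {m n : ℕ} (x : Γ) {y : Λ} {z : Γ} (w : Λ) (hy : y ∈ Λ.deg m)
    (hz : z ∈ Γ.deg n) :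
    stmul x y * stmul z w = (-1 : ℂ) ^ (m * n) • stmul (x * z) (y * w) := by
  have h := GradedTensorProduct.tmul_coe_mul_coe_tmul (R := ℂ) Γ.deg Λ.deg x ⟨y, hy⟩ ⟨z, hz⟩ w
  refine h.trans ?_
  rcases Nat.even_or_odd (m * n) with e | e
  · rw [e.neg_one_pow, e.neg_one_pow, one_smul, one_smul]
  · rw [e.neg_one_pow, e.neg_one_pow, neg_smul, Units.neg_smul, one_smul, one_smul]

theorem skew_induction {p : SkewTensor Γ Λ → Prop} (x : SkewTensor Γ Λ)
    (hom : ∀ m n, ∀ a ∈ Γ.deg m, ∀ b ∈ Λ.deg n, p (stmul a b)) (zero : p 0)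
    (add : ∀ y z, p y → p z → p (y + z)) : p x := by
  refine TensorProduct.induction_on (motive := p) x zero (fun a b => ?_) add
  induction a using Γ.hom_induction with
  | hom m a ha =>
    induction b using Λ.hom_induction with
    | hom n b hb => exact hom m n a ha b hb
    | zero => rw [TensorProduct.tmul_zero]; exact zero
    | add b c hb hc => rw [TensorProduct.tmul_add]; exact add _ _ hb hc
  | zero => rw [TensorProduct.zero_tmul]; exact zero
  | add a c ha hc => rw [TensorProduct.add_tmul]; exact add _ _ ha hc

/-- The component of degree `n` of the skew tensor product: `⨁_{k + l = n} Γᵏ ⊗ Λˡ`. -/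
def skewDeg (n : ℕ) : Submodule ℂ (SkewTensor Γ Λ) :=
  Submodule.span ℂ {x | ∃ k l, k + l = n ∧ ∃ a ∈ Γ.deg k, ∃ b ∈ Λ.deg l, stmul a b = x}

variable {Γ Λ} in
theorem stmul_mem {k l : ℕ} {a : Γ} {b : Λ} (ha : a ∈ Γ.deg k) (hb : b ∈ Λ.deg l) :
    stmul a b ∈ skewDeg Γ Λ (k + l) :=
  Submodule.subset_span ⟨k, l, rfl, a, ha, b, hb, rfl⟩

/-- The differential `d(γ ⊗ ρ) = dγ ⊗ ρ + (-1)ⁿ γ ⊗ dρ`, `γ ∈ Γⁿ`, of the skew tensor product. -/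
def skewD : SkewTensor Γ Λ →ₗ[ℂ] SkewTensor Γ Λ :=
  (GradedTensorProduct.of ℂ Γ.deg Λ.deg).toLinearMap ∘ₗ
    (TensorProduct.map Γ.d LinearMap.id + TensorProduct.map Γ.sign Λ.d) ∘ₗ
      (GradedTensorProduct.of ℂ Γ.deg Λ.deg).symm.toLinearMap

variable {Γ Λ} in
theorem stmul_smul (c : ℂ) (a : Γ) (b : Λ) : stmul a (c • b) = c • stmul a b := by
  rw [stmul, stmul, GradedTensorProduct.tmul, TensorProduct.tmul_smul, map_smul]

variable {Γ Λ} in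
theorem smul_stmul (c : ℂ) (a : Γ) (b : Λ) : stmul (c • a) b = c • stmul a b := by
  rw [stmul, stmul, GradedTensorProduct.tmul, ← TensorProduct.smul_tmul', map_smul]

variable {Γ Λ} in
theorem stmul_zero (a : Γ) : stmul a (0 : Λ) = 0 := by
  rw [stmul, GradedTensorProduct.tmul, TensorProduct.tmul_zero, map_zero]

variable {Γ Λ} in
theorem zero_stmul (b : Λ) : stmul (0 : Γ) b = 0 := by
  rw [stmul, GradedTensorProduct.tmul, TensorProduct.zero_tmul, map_zero]

variable {Γ Λ} in
theorem stmul_add (a : Γ) (b c : Λ) : stmul a (b + c) = stmul a b + stmul a c := by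
  rw [stmul, GradedTensorProduct.tmul, TensorProduct.tmul_add, map_add]

variable {Γ Λ} in
theorem add_stmul (a c : Γ) (b : Λ) : stmul (a + c) b = stmul a b + stmul c b := by
  rw [stmul, GradedTensorProduct.tmul, TensorProduct.add_tmul, map_add]

theorem skewD_stmul {n : ℕ} {a : Γ} (ha : a ∈ Γ.deg n) (b : Λ) :
    skewD Γ Λ (stmul a b) = stmul (Γ.d a) b + (-1 : ℂ) ^ n • stmul a (Λ.d b) := by
  rw [← smul_stmul, ← Γ.sign_of_mem ha]
  rfl

/-- The skew tensor product `Γ ⊗̂ Λ` of differential algebras. -/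
def skew : DiffAlg where
  carrier := SkewTensor Γ Λ
  deg := skewDeg Γ Λ
  internal := by
    let pr : ℕ → SkewTensor Γ Λ →ₗ[ℂ] SkewTensor Γ Λ := fun n =>
      (GradedTensorProduct.of ℂ Γ.deg Λ.deg).toLinearMap ∘ₗ
        (∑ kl ∈ Finset.HasAntidiagonal.antidiagonal n, TensorProduct.map (Γ.proj kl.1) (Λ.proj kl.2)) ∘ₗ
          (GradedTensorProduct.of ℂ Γ.deg Λ.deg).symm.toLinearMap
    have hpr : ∀ n a b, pr n (stmul a b) =
        ∑ kl ∈ Finset.HasAntidiagonal.antidiagonal n, stmul (Γ.proj kl.1 a) (Λ.proj kl.2 b) := by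
      intro n a b
      simp [pr, stmul]
    refine isInternal_of_proj _ pr ?_ ?_
    · intro m n x hx
      induction hx using Submodule.span_induction with
      | mem x hx =>
        obtain ⟨k, l, rfl, a, ha, b, hb, rfl⟩ := hx
        rw [hpr]
        have : ∀ kl ∈ Finset.HasAntidiagonal.antidiagonal m, stmul (Γ.proj kl.1 a) (Λ.proj kl.2 b) =
            if kl = (k, l) then stmul a b else 0 := by
          rintro ⟨k', l'⟩ -
          rw [Γ.proj_of_mem _ k a ha, Λ.proj_of_mem _ l b hb]
          by_cases h1 : k' = k <;> by_cases h2 : l' = l <;> simp [h1, h2, stmul]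
        rw [Finset.sum_congr rfl this, Finset.sum_ite_eq']
        simp [eq_comm]
      | zero => simp
      | add x y _ _ hx hy => rw [map_add, hx, hy]; split_ifs <;> simp
      | smul c x _ hx => rw [map_smul, hx]; split_ifs <;> simp
    · rw [eq_top_iff]
      rintro x -
      induction x using skew_induction with
      | hom m n a ha b hb => exact Submodule.mem_iSup_of_mem (m + n) (stmul_mem ha hb)
      | zero => exact zero_mem _
      | add y z hy hz => exact add_mem hy hz
  one_mem := Submodule.subset_span ⟨0, 0, rfl, 1, Γ.one_mem, 1, Λ.one_mem, rfl⟩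
  mul_mem := by
    intro m n x y hx hy
    induction hx using Submodule.span_induction with
    | mem x hx =>
      obtain ⟨k, l, rfl, a, ha, b, hb, rfl⟩ := hx
      induction hy using Submodule.span_induction with
      | mem y hy =>
        obtain ⟨k', l', rfl, a', ha', b', hb', rfl⟩ := hy
        rw [stmul_mul Γ Λ a b' hb ha', add_add_add_comm]
        exact Submodule.smul_mem _ _ (stmul_mem (Γ.mul_mem ha ha') (Λ.mul_mem hb hb'))
      | zero => rw [mul_zero]; exact zero_mem _
      | add y z _ _ hy hz => rw [mul_add]; exact add_mem hy hz
      | smul c y _ hy => rw [mul_smul_comm]; exact Submodule.smul_mem _ _ hy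
    | zero => rw [zero_mul]; exact zero_mem _
    | add y z _ _ hy hz => rw [add_mul]; exact add_mem hy hz
    | smul c y _ hy => rw [smul_mul_assoc]; exact Submodule.smul_mem _ _ hy
  d := skewD Γ Λ
  d_mem := by
    intro n x hx
    induction hx using Submodule.span_induction with
    | mem x hx =>
      obtain ⟨k, l, rfl, a, ha, b, hb, rfl⟩ := hx
      rw [skewD_stmul Γ Λ ha]
      refine add_mem ?_ (Submodule.smul_mem _ _ ?_)
      · rw [add_right_comm]
        exact stmul_mem (Γ.d_mem ha) hb
      · rw [add_assoc]; exact stmul_mem ha (Λ.d_mem hb)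
    | zero => rw [map_zero]; exact zero_mem _
    | add y z _ _ hy hz => rw [map_add]; exact add_mem hy hz
    | smul c y _ hy => rw [map_smul]; exact Submodule.smul_mem _ _ hy
  leibniz := by
    intro n x hx y
    induction hx using Submodule.span_induction with
    | mem x hx =>
      obtain ⟨i, j, rfl, a, ha, b, hb, rfl⟩ := hx
      induction y using skew_induction with
      | hom k l c hc e he =>
        rw [stmul_mul Γ Λ a e hb hc, map_smul, skewD_stmul Γ Λ (Γ.mul_mem ha hc),
          skewD_stmul Γ Λ ha, skewD_stmul Γ Λ hc, Γ.leibniz ha, Λ.leibniz hb, add_mul, mul_add,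
          stmul_mul Γ Λ _ e hb hc, smul_mul_assoc, stmul_mul Γ Λ a e (Λ.d_mem hb) hc,
          stmul_mul Γ Λ a e hb (Γ.d_mem hc), mul_smul_comm, stmul_mul Γ Λ a _ hb hc]
        rw [add_stmul, stmul_add, smul_stmul, stmul_smul]
        have h2 : ∀ t : ℕ, ((-1 : ℂ) ^ t) * ((-1 : ℂ) ^ t) = 1 := fun t => by
          rw [← mul_pow]; norm_num
        simp only [smul_add, smul_smul]
        rw [add_assoc, add_assoc]
        congr 1
        have s1 : (-1 : ℂ) ^ (j * k) * (-1) ^ i = (-1) ^ (i + j) * (-1) ^ (j * (k + 1)) := by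
          rw [mul_add, mul_one, pow_add, pow_add]
          linear_combination (-(-1 : ℂ) ^ (j * k) * (-1) ^ i) * h2 j
        have s2 : (-1 : ℂ) ^ (j * k) * (-1) ^ (i + k) = (-1) ^ i * (-1) ^ ((j + 1) * k) := by
          rw [add_mul, one_mul, pow_add, pow_add]; ring
        have s3 : (-1 : ℂ) ^ (j * k) * ((-1) ^ (i + k) * (-1) ^ j) =
            (-1) ^ (i + j) * ((-1) ^ k * (-1) ^ (j * k)) := by
          rw [pow_add, pow_add]; ring
        rw [← s1, s2, s3]
        abel
      | zero => simp
      | add y z hy hz => rw [mul_add, map_add, hy, hz, map_add, mul_add, mul_add, smul_add]; abel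
    | zero => simp
    | add x z _ _ hx hz => rw [add_mul, map_add, hx, hz, map_add, add_mul, add_mul, smul_add]; abel
    | smul c x _ hx =>
      rw [smul_mul_assoc, map_smul, hx, map_smul, smul_mul_assoc, smul_add, smul_mul_assoc,
        smul_comm c]
  d_d := by
    intro x
    induction x using skew_induction with
    | hom m n a ha b hb =>
      rw [skewD_stmul Γ Λ ha, map_add, map_smul, skewD_stmul Γ Λ (Γ.d_mem ha),
        skewD_stmul Γ Λ ha, Γ.d_d, Λ.d_d]
      rw [zero_stmul, stmul_zero, smul_zero, add_zero, zero_add, pow_succ, mul_neg_one, neg_smul, neg_add_cancel]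
    | zero => simp
    | add y z hy hz => rw [map_add, map_add, hy, hz, add_zero]

end Skew

end DiffAlg

namespace DiffAlg

/-! ### The universal differential calculus -/

section Omega

variable (A : Type*) [Ring A] [Algebra ℂ A]

/-- The relations between the generators `a` (`Sum.inl a`) and `da` (`Sum.inr a`), `a ∈ A`, of the
universal differential calculus. -/
inductive OmegaRel : FreeAlgebra ℂ (A ⊕ A) → FreeAlgebra ℂ (A ⊕ A) → Prop
  | one : OmegaRel (FreeAlgebra.ι ℂ (Sum.inl 1)) 1
  | add (a b : A) : OmegaRel (FreeAlgebra.ι ℂ (Sum.inl (a + b)))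
      (FreeAlgebra.ι ℂ (Sum.inl a) + FreeAlgebra.ι ℂ (Sum.inl b))
  | smul (c : ℂ) (a : A) : OmegaRel (FreeAlgebra.ι ℂ (Sum.inl (c • a)))
      (c • FreeAlgebra.ι ℂ (Sum.inl a))
  | mul (a b : A) : OmegaRel (FreeAlgebra.ι ℂ (Sum.inl (a * b)))
      (FreeAlgebra.ι ℂ (Sum.inl a) * FreeAlgebra.ι ℂ (Sum.inl b))
  | d_add (a b : A) : OmegaRel (FreeAlgebra.ι ℂ (Sum.inr (a + b)))
      (FreeAlgebra.ι ℂ (Sum.inr a) + FreeAlgebra.ι ℂ (Sum.inr b))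
  | d_smul (c : ℂ) (a : A) : OmegaRel (FreeAlgebra.ι ℂ (Sum.inr (c • a)))
      (c • FreeAlgebra.ι ℂ (Sum.inr a))
  | d_mul (a b : A) : OmegaRel (FreeAlgebra.ι ℂ (Sum.inr (a * b)))
      (FreeAlgebra.ι ℂ (Sum.inr a) * FreeAlgebra.ι ℂ (Sum.inl b) +
        FreeAlgebra.ι ℂ (Sum.inl a) * FreeAlgebra.ι ℂ (Sum.inr b))

/-- The algebra underlying the universal differential calculus `Ω(A)`: it is generated by the
algebra `A` and symbols `da`, linear in `a ∈ A`, subject to `d(ab) = (da)b + a(db)`. -/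
def OmegaAlg : Type _ := RingQuot (OmegaRel A)

instance : Ring (OmegaAlg A) := inferInstanceAs (Ring (RingQuot (OmegaRel A)))

instance : Algebra ℂ (OmegaAlg A) := inferInstanceAs (Algebra ℂ (RingQuot (OmegaRel A)))

/-- The quotient map from the free algebra. -/
def omegaMk : FreeAlgebra ℂ (A ⊕ A) →ₐ[ℂ] OmegaAlg A := RingQuot.mkAlgHom ℂ (OmegaRel A)

variable {A}

/-- The generator `da` of `Ω(A)`. -/
def omegaD (a : A) : OmegaAlg A :=
  omegaMk A (FreeAlgebra.ι ℂ (Sum.inr a))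

theorem omega_rel {x y : FreeAlgebra ℂ (A ⊕ A)} (h : OmegaRel A x y) :
    omegaMk A x = omegaMk A y :=
  RingQuot.mkAlgHom_rel ℂ h

variable (A) in
/-- The inclusion `A → Ω(A)`. -/
def omegaOf : A →ₐ[ℂ] OmegaAlg A :=
  AlgHom.ofLinearMap
    { toFun := fun a => omegaMk A (FreeAlgebra.ι ℂ (Sum.inl a))
      map_add' := fun a b => by rw [omega_rel (OmegaRel.add a b), map_add]
      map_smul' := fun c a => by rw [omega_rel (OmegaRel.smul c a), map_smul]; rfl }
    ((omega_rel OmegaRel.one).trans (map_one _))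
    (fun a b => (omega_rel (OmegaRel.mul a b)).trans (map_mul _ _ _))

theorem omegaD_add (a b : A) : omegaD (a + b) = omegaD a + omegaD b :=
  (omega_rel (OmegaRel.d_add a b)).trans (map_add _ _ _)

theorem omegaD_smul (c : ℂ) (a : A) : omegaD (c • a) = c • omegaD a :=
  (omega_rel (OmegaRel.d_smul c a)).trans (map_smul _ _ _)

theorem omegaD_mul (a b : A) :
    omegaD (a * b) = omegaD a * omegaOf A b + omegaOf A a * omegaD b :=
  (omega_rel (OmegaRel.d_mul a b)).trans (by rw [map_add, map_mul, map_mul]; rfl)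

theorem omega_induction {p : OmegaAlg A → Prop} (x : OmegaAlg A)
    (of : ∀ a, p (omegaOf A a)) (d : ∀ a, p (omegaD a))
    (mul : ∀ x y, p x → p y → p (x * y)) (add : ∀ x y, p x → p y → p (x + y)) : p x := by
  obtain ⟨x, rfl⟩ : ∃ y, omegaMk A y = x := RingQuot.mkAlgHom_surjective ℂ (OmegaRel A) x
  induction x using FreeAlgebra.induction with
  | grade0 c =>
    rw [AlgHom.commutes, ← (omegaOf A).commutes]
    exact of _
  | grade1 x =>
    rcases x with a | a
    · exact of a
    · exact d a
  | mul x y hx hy => rw [map_mul]; exact mul _ _ hx hy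
  | add x y hx hy => rw [map_add]; exact add _ _ hx hy

variable {C : Type*} [Ring C] [Algebra ℂ C]

/-- Algebra homomorphisms out of `Ω(A)`. -/
def omegaLiftAlg (f : A →ₐ[ℂ] C) (g : A →ₗ[ℂ] C)
    (hg : ∀ a b, g (a * b) = g a * f b + f a * g b) : OmegaAlg A →ₐ[ℂ] C :=
  RingQuot.liftAlgHom ℂ ⟨FreeAlgebra.lift ℂ (Sum.elim f g), by
    intro x y h
    induction h <;> simp [hg]⟩

theorem omegaLiftAlg_of (f : A →ₐ[ℂ] C) (g : A →ₗ[ℂ] C)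
    (hg : ∀ a b, g (a * b) = g a * f b + f a * g b) (a : A) :
    omegaLiftAlg f g hg (omegaOf A a) = f a := by
  change RingQuot.liftAlgHom ℂ _ (RingQuot.mkAlgHom ℂ (OmegaRel A) _) = _
  rw [RingQuot.liftAlgHom_mkAlgHom_apply, FreeAlgebra.lift_ι_apply]
  rfl

theorem omegaLiftAlg_d (f : A →ₐ[ℂ] C) (g : A →ₗ[ℂ] C)
    (hg : ∀ a b, g (a * b) = g a * f b + f a * g b) (a : A) :
    omegaLiftAlg f g hg (omegaD a) = g a := by
  change RingQuot.liftAlgHom ℂ _ (RingQuot.mkAlgHom ℂ (OmegaRel A) _) = _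
  rw [RingQuot.liftAlgHom_mkAlgHom_apply, FreeAlgebra.lift_ι_apply]
  rfl

variable (A)

/-- `a ↦ da` as a linear map. -/
def omegaDLin : A →ₗ[ℂ] OmegaAlg A where
  toFun := omegaD
  map_add' := omegaD_add
  map_smul' := omegaD_smul

/-- The algebra homomorphism `Ω(A) → Ω(A)[T]` with `a ↦ a` and `da ↦ (da)T`, which counts the
number of factors `da`. -/
def omegaCount : OmegaAlg A →ₐ[ℂ] Polynomial (OmegaAlg A) :=
  omegaLiftAlg ((Polynomial.CAlgHom (R := ℂ) (A := OmegaAlg A)).comp (omegaOf A))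
    { toFun := fun a => Polynomial.monomial 1 (omegaD a)
      map_add' := fun a b => by rw [omegaD_add, map_add]
      map_smul' := fun c a => by rw [omegaD_smul, ← Polynomial.smul_monomial]; rfl }
    (fun a b => by
      change Polynomial.monomial 1 (omegaD (a * b)) =
        Polynomial.monomial 1 (omegaD a) * Polynomial.C (omegaOf A b) +
          Polynomial.C (omegaOf A a) * Polynomial.monomial 1 (omegaD b)
      rw [omegaD_mul, map_add, Polynomial.monomial_mul_C, Polynomial.C_mul_monomial])

/-- The component `Ωⁿ(A)`: the elements with exactly `n` factors `da`. -/
def omegaDeg (n : ℕ) : Submodule ℂ (OmegaAlg A) where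
  carrier := {x | omegaCount A x = Polynomial.monomial n x}
  add_mem' {x y} hx hy := by
    change omegaCount A (x + y) = _
    rw [map_add, map_add, hx, hy]
  zero_mem' := by
    change omegaCount A 0 = _
    rw [map_zero, map_zero]
  smul_mem' c x hx := by
    change omegaCount A (c • x) = _
    rw [map_smul, hx, Polynomial.smul_monomial]

variable {A}

theorem omegaDeg_iff {n : ℕ} {x : OmegaAlg A} :
    x ∈ omegaDeg A n ↔ omegaCount A x = Polynomial.monomial n x := Iff.rfl

theorem omegaOf_mem (a : A) : omegaOf A a ∈ omegaDeg A 0 := omegaLiftAlg_of _ _ _ a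

theorem omegaD_mem (a : A) : omegaD a ∈ omegaDeg A 1 := omegaLiftAlg_d _ _ _ a

theorem omega_mul_mem {m n : ℕ} {x y : OmegaAlg A} (hx : x ∈ omegaDeg A m)
    (hy : y ∈ omegaDeg A n) : x * y ∈ omegaDeg A (m + n) := by
  rw [omegaDeg_iff] at *
  rw [map_mul, hx, hy, Polynomial.monomial_mul_monomial]

theorem omega_iSup (S : ℕ → Submodule ℂ (OmegaAlg A)) (hof : ∀ a, omegaOf A a ∈ S 0)
    (hd : ∀ a, omegaD a ∈ S 1)
    (hmul : ∀ m n x y, x ∈ S m → y ∈ S n → x * y ∈ S (m + n)) : ⨆ n, S n = ⊤ := by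
  rw [eq_top_iff]
  rintro x -
  induction x using omega_induction with
  | of a => exact Submodule.mem_iSup_of_mem 0 (hof a)
  | d a => exact Submodule.mem_iSup_of_mem 1 (hd a)
  | mul x y hx hy =>
    induction hx using Submodule.iSup_induction' with
    | mem m x hx =>
      induction hy using Submodule.iSup_induction' with
      | mem n y hy => exact Submodule.mem_iSup_of_mem (m + n) (hmul _ _ _ _ hx hy)
      | zero => rw [mul_zero]; exact zero_mem _
      | add y z _ _ hy hz => rw [mul_add]; exact add_mem hy hz
    | zero => rw [zero_mul]; exact zero_mem _
    | add x z _ _ hx hz => rw [add_mul]; exact add_mem hx hz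
  | add x y hx hy => exact add_mem hx hy

theorem omega_internal : DirectSum.IsInternal (omegaDeg A) := by
  refine isInternal_of_proj _
    (fun n => (Polynomial.lcoeff (OmegaAlg A) n).restrictScalars ℂ ∘ₗ (omegaCount A).toLinearMap)
    ?_ (omega_iSup _ omegaOf_mem omegaD_mem fun _ _ _ _ => omega_mul_mem)
  intro m n x hx
  change (omegaCount A x).coeff m = _
  rw [omegaDeg_iff.mp hx, Polynomial.coeff_monomial]
  simp only [eq_comm]

/-- Induction on homogeneous elements of `Ω(A)`. -/
theorem omega_homog_induction {n : ℕ} {x : OmegaAlg A} (hx : x ∈ omegaDeg A n)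
    (T : ℕ → Submodule ℂ (OmegaAlg A)) (hof : ∀ a, omegaOf A a ∈ T 0) (hd : ∀ a, omegaD a ∈ T 1)
    (hmul : ∀ m n x y, x ∈ omegaDeg A m → y ∈ omegaDeg A n → x ∈ T m → y ∈ T n →
      x * y ∈ T (m + n)) : x ∈ T n := by
  have hS : ⨆ n, omegaDeg A n ⊓ T n = ⊤ :=
    omega_iSup _ (fun a => ⟨omegaOf_mem a, hof a⟩) (fun a => ⟨omegaD_mem a, hd a⟩)
      fun m n x y hx hy => ⟨omega_mul_mem hx.1 hy.1, hmul m n x y hx.1 hy.1 hx.2 hy.2⟩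
  have key : ∀ y : OmegaAlg A, ∀ k, (omegaCount A y).coeff k ∈ T k := by
    intro y k
    have hy : y ∈ ⨆ n, omegaDeg A n ⊓ T n := hS ▸ Submodule.mem_top
    induction hy using Submodule.iSup_induction' with
    | mem m y hy =>
      rw [omegaDeg_iff.mp hy.1, Polynomial.coeff_monomial]
      split_ifs with h
      · exact h ▸ hy.2
      · exact zero_mem _
    | zero => rw [map_zero]; exact zero_mem _
    | add y z _ _ hy hz => rw [map_add, Polynomial.coeff_add]; exact add_mem hy hz
  have h := key x n
  rwa [omegaDeg_iff.mp hx, Polynomial.coeff_monomial_same] at h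

variable (A)

/-- The algebra homomorphism `ω ↦ !![σ(ω), dω; 0, ω]`, where `σ(ω) = (-1)ⁿω` for `ω ∈ Ωⁿ(A)`. Its
multiplicativity expresses the graded Leibniz rule. -/
def omegaMat : OmegaAlg A →ₐ[ℂ] Matrix (Fin 2) (Fin 2) (OmegaAlg A) :=
  omegaLiftAlg
    (AlgHom.ofLinearMap
      { toFun := fun a => !![omegaOf A a, omegaD a; 0, omegaOf A a]
        map_add' := fun a b => by
          ext i j; fin_cases i <;> fin_cases j <;> simp [omegaD_add]
        map_smul' := fun c a => by
          ext i j; fin_cases i <;> fin_cases j <;> simp [omegaD_smul] }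
      (by
        have h : omegaD (1 : A) = 0 := by
          have := omegaD_mul (1 : A) 1
          simpa using this
        ext i j; fin_cases i <;> fin_cases j <;> simp [h])
      (fun a b => by
        ext i j; fin_cases i <;> fin_cases j <;>
          simp [Matrix.mul_apply, Fin.sum_univ_two, omegaD_mul, add_comm]))
    { toFun := fun a => !![-omegaD a, 0; 0, omegaD a]
      map_add' := fun a b => by
        ext i j; fin_cases i <;> fin_cases j <;> simp [omegaD_add, add_comm]
      map_smul' := fun c a => by
        ext i j; fin_cases i <;> fin_cases j <;> simp [omegaD_smul] }
    (fun a b => by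
      change !![-omegaD (a * b), 0; 0, omegaD (a * b)] =
        !![-omegaD a, 0; 0, omegaD a] * !![omegaOf A b, omegaD b; 0, omegaOf A b] +
          !![omegaOf A a, omegaD a; 0, omegaOf A a] * !![-omegaD b, 0; 0, omegaD b]
      rw [Matrix.mul_fin_two, Matrix.mul_fin_two, omegaD_mul]
      ext i j; fin_cases i <;> fin_cases j <;> simp [add_comm])

variable {A}

theorem omegaMat_of (a : A) :
    omegaMat A (omegaOf A a) = !![omegaOf A a, omegaD a; 0, omegaOf A a] :=
  omegaLiftAlg_of _ _ _ a

theorem omegaMat_d (a : A) : omegaMat A (omegaD a) = !![-omegaD a, 0; 0, omegaD a] :=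
  omegaLiftAlg_d _ _ _ a

theorem omegaMat_lower (x : OmegaAlg A) : omegaMat A x 1 0 = 0 ∧ omegaMat A x 1 1 = x := by
  induction x using omega_induction with
  | of a => rw [omegaMat_of]; simp
  | d a => rw [omegaMat_d]; simp
  | mul x y hx hy => simp [map_mul, Matrix.mul_apply, Fin.sum_univ_two, hx, hy]
  | add x y hx hy => simp [map_add, hx, hy]

theorem omegaMat_sign {n : ℕ} {x : OmegaAlg A} (hx : x ∈ omegaDeg A n) :
    omegaMat A x 0 0 = (-1 : ℂ) ^ n • x := by
  have key : ∀ y : OmegaAlg A, omegaMat A y 0 0 = (omegaCount A y).eval (-1) := by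
    intro y
    induction y using omega_induction with
    | of a => rw [omegaMat_of, omegaDeg_iff.mp (omegaOf_mem a)]; simp
    | d a => rw [omegaMat_d, omegaDeg_iff.mp (omegaD_mem a)]; simp
    | mul x y hx hy =>
      rw [map_mul, map_mul, Polynomial.eval, Polynomial.eval₂_mul_noncomm _ _
        fun k => Commute.neg_one_right ((omegaCount A y).coeff k)]
      rw [← Polynomial.eval, ← Polynomial.eval, ← hx, ← hy]
      simp [Matrix.mul_apply, Fin.sum_univ_two, omegaMat_lower]
    | add x y hx hy => rw [map_add, map_add, Polynomial.eval_add, ← hx, ← hy]; rfl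
  rw [key, omegaDeg_iff.mp hx, Polynomial.eval_monomial]
  rcases Nat.even_or_odd n with e | e <;> rw [e.neg_one_pow, e.neg_one_pow] <;> simp

variable (A) in
/-- The differential of `Ω(A)`. -/
def omegaDiff : OmegaAlg A →ₗ[ℂ] OmegaAlg A where
  toFun x := omegaMat A x 0 1
  map_add' x y := by rw [map_add]; rfl
  map_smul' c x := by rw [map_smul]; rfl

theorem omegaDiff_of (a : A) : omegaDiff A (omegaOf A a) = omegaD a := by
  change omegaMat A _ 0 1 = _
  rw [omegaMat_of]; rfl

theorem omegaDiff_d (a : A) : omegaDiff A (omegaD a) = 0 := by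
  change omegaMat A _ 0 1 = _
  rw [omegaMat_d]; rfl

theorem omegaDiff_mul {n : ℕ} {x : OmegaAlg A} (hx : x ∈ omegaDeg A n) (y : OmegaAlg A) :
    omegaDiff A (x * y) = omegaDiff A x * y + (-1 : ℂ) ^ n • (x * omegaDiff A y) := by
  change omegaMat A (x * y) 0 1 = omegaMat A x 0 1 * y + (-1 : ℂ) ^ n • (x * omegaMat A y 0 1)
  rw [map_mul, Matrix.mul_apply, Fin.sum_univ_two, omegaMat_sign hx, (omegaMat_lower y).2,
    smul_mul_assoc, add_comm]

theorem omegaDiff_mem {n : ℕ} {x : OmegaAlg A} (hx : x ∈ omegaDeg A n) :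
    omegaDiff A x ∈ omegaDeg A (n + 1) := by
  refine omega_homog_induction hx (fun n => (omegaDeg A (n + 1)).comap (omegaDiff A)) ?_ ?_ ?_
  · intro a
    rw [Submodule.mem_comap, omegaDiff_of]; exact omegaD_mem a
  · intro a
    rw [Submodule.mem_comap, omegaDiff_d]; exact zero_mem _
  · intro m n x y hx hy hx' hy'
    rw [Submodule.mem_comap] at *
    rw [omegaDiff_mul hx]
    refine add_mem ?_ (Submodule.smul_mem _ _ ?_)
    · rw [add_right_comm]; exact omega_mul_mem hx' hy
    · rw [add_assoc]; exact omega_mul_mem hx hy'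

theorem omegaDiff_sq (x : OmegaAlg A) : omegaDiff A (omegaDiff A x) = 0 := by
  have key : ∀ n, ∀ y ∈ omegaDeg A n, omegaDiff A (omegaDiff A y) = 0 := by
    intro n y hy
    refine omega_homog_induction hy (fun n => LinearMap.ker (omegaDiff A ∘ₗ omegaDiff A)) ?_ ?_ ?_
    · intro a
      rw [LinearMap.mem_ker, LinearMap.comp_apply, omegaDiff_of, omegaDiff_d]
    · intro a
      rw [LinearMap.mem_ker, LinearMap.comp_apply, omegaDiff_d, map_zero]
    · intro m n x y hx hy hx' hy'
      rw [LinearMap.mem_ker, LinearMap.comp_apply] at *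
      rw [omegaDiff_mul hx, map_add, map_smul, omegaDiff_mul (omegaDiff_mem hx), omegaDiff_mul hx,
        hx', hy', pow_succ, mul_neg_one, neg_smul, zero_mul, zero_add, mul_zero, smul_zero,
        add_zero, neg_add_cancel]
  have hx : x ∈ ⨆ n, omegaDeg A n :=
    (omega_internal (A := A)).submodule_iSup_eq_top ▸ Submodule.mem_top
  induction hx using Submodule.iSup_induction' with
  | mem m y hy => exact key m y hy
  | zero => rw [map_zero, map_zero]
  | add y z _ _ hy hz => rw [map_add, map_add, hy, hz, add_zero]

end Omega

/-- The universal differential calculus `Ω(A)`. -/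
def omega (A : Type*) [Ring A] [Algebra ℂ A] : DiffAlg where
  carrier := OmegaAlg A
  deg := omegaDeg A
  internal := omega_internal
  one_mem := by rw [← map_one (omegaOf A)]; exact omegaOf_mem 1
  mul_mem := omega_mul_mem
  d := omegaDiff A
  d_mem := omegaDiff_mem
  leibniz := omegaDiff_mul
  d_d := omegaDiff_sq

section OmegaMaps

/-- The inclusion `A → Ω(A)`, onto the component of degree zero. -/
def omegaIn (A : Type*) [Ring A] [Algebra ℂ A] : A →ₐ[ℂ] omega A := omegaOf A

variable {A : Type*} [Ring A] [Algebra ℂ A] {Γ : DiffAlg}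

/-- The algebra homomorphism `a ↦ f(a)`, `da ↦ d(f(a))`. -/
def omegaExt (f : A →ₐ[ℂ] Γ) (hf : ∀ a, f a ∈ Γ.deg 0) : OmegaAlg A →ₐ[ℂ] Γ :=
  omegaLiftAlg f (Γ.d ∘ₗ f.toLinearMap) fun a b => by
    change Γ.d (f (a * b)) = Γ.d (f a) * f b + f a * Γ.d (f b)
    rw [map_mul, Γ.leibniz (hf a), pow_zero, one_smul]

variable (f : A →ₐ[ℂ] Γ) (hf : ∀ a, f a ∈ Γ.deg 0)

theorem omegaExt_of (a : A) : omegaExt f hf (omegaOf A a) = f a := omegaLiftAlg_of _ _ _ a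

theorem omegaExt_d (a : A) : omegaExt f hf (omegaD a) = Γ.d (f a) := omegaLiftAlg_d _ _ _ a

theorem omegaExt_mem {n : ℕ} {x : OmegaAlg A} (hx : x ∈ omegaDeg A n) :
    omegaExt f hf x ∈ Γ.deg n := by
  refine omega_homog_induction hx (fun n => (Γ.deg n).comap (omegaExt f hf).toLinearMap) ?_ ?_ ?_
  · intro a
    rw [Submodule.mem_comap, AlgHom.toLinearMap_apply, omegaExt_of]; exact hf a
  · intro a
    rw [Submodule.mem_comap, AlgHom.toLinearMap_apply, omegaExt_d]; exact Γ.d_mem (hf a)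
  · intro m n x y _ _ hx hy
    rw [Submodule.mem_comap, AlgHom.toLinearMap_apply] at *
    rw [map_mul]
    exact Γ.mul_mem hx hy

theorem omegaExt_diff (x : OmegaAlg A) :
    omegaExt f hf (omegaDiff A x) = Γ.d (omegaExt f hf x) := by
  have key : ∀ n, ∀ y ∈ omegaDeg A n,
      omegaExt f hf (omegaDiff A y) = Γ.d (omegaExt f hf y) := by
    intro n y hy
    refine omega_homog_induction hy (fun n => LinearMap.eqLocus
      ((omegaExt f hf).toLinearMap ∘ₗ omegaDiff A) (Γ.d ∘ₗ (omegaExt f hf).toLinearMap)) ?_ ?_ ?_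
    · intro a
      change omegaExt f hf (omegaDiff A (omegaOf A a)) = Γ.d (omegaExt f hf (omegaOf A a))
      rw [omegaDiff_of, omegaExt_of, omegaExt_d]
    · intro a
      change omegaExt f hf (omegaDiff A (omegaD a)) = Γ.d (omegaExt f hf (omegaD a))
      rw [omegaDiff_d, omegaExt_d, map_zero, Γ.d_d]
    · intro m n x y hx hy h2 h4
      have h2 : omegaExt f hf (omegaDiff A x) = Γ.d (omegaExt f hf x) := h2
      have h4 : omegaExt f hf (omegaDiff A y) = Γ.d (omegaExt f hf y) := h4
      change omegaExt f hf (omegaDiff A (x * y)) = Γ.d (omegaExt f hf (x * y))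
      rw [omegaDiff_mul hx, map_add, map_mul, map_smul, map_mul, map_mul, h2, h4,
        Γ.leibniz (omegaExt_mem f hf hx)]
  have hx : x ∈ ⨆ n, omegaDeg A n :=
    (omega_internal (A := A)).submodule_iSup_eq_top ▸ Submodule.mem_top
  induction hx using Submodule.iSup_induction' with
  | mem m y hy => exact key m y hy
  | zero => rw [map_zero, map_zero, map_zero]
  | add y z _ _ hy hz => rw [map_add, map_add, hy, hz, map_add, map_add]

/-- The extension `Ω(A) → Γ` of an algebra homomorphism `f : A → Γ⁰` to a homomorphism of
differential algebras. -/
def omegaLift : Hom (omega A) Γ where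
  toAlgHom := omegaExt f hf
  map_deg := omegaExt_mem f hf
  map_d := omegaExt_diff f hf

theorem omegaLift_of (a : A) : omegaLift f hf (omegaIn A a) = f a := omegaExt_of f hf a

/-- A homomorphism of differential algebras on `Ω(A)` is determined by its values on `A`. -/
theorem omega_hom_ext {f g : Hom (omega A) Γ} (h : ∀ a, f (omegaIn A a) = g (omegaIn A a))
    (x : omega A) : f x = g x := by
  refine omega_induction (p := fun x => f x = g x) x h ?_ ?_ ?_
  · intro a
    rw [← omegaDiff_of]
    exact (f.comm_d _).trans ((congrArg Γ.d (h a)).trans (g.comm_d _).symm)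
  · intro x y hx hy
    change f.toAlgHom (show omega A from x) = g.toAlgHom (show omega A from x) at hx
    change f.toAlgHom (show omega A from y) = g.toAlgHom (show omega A from y) at hy
    change f.toAlgHom ((show omega A from x) * (show omega A from y)) =
      g.toAlgHom ((show omega A from x) * (show omega A from y))
    rw [map_mul, map_mul, hx, hy]
  · intro x y hx hy
    change f.toAlgHom (show omega A from x) = g.toAlgHom (show omega A from x) at hx
    change f.toAlgHom (show omega A from y) = g.toAlgHom (show omega A from y) at hy
    change f.toAlgHom ((show omega A from x) + (show omega A from y)) =
      g.toAlgHom ((show omega A from x) + (show omega A from y))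
    rw [map_add, map_add, hx, hy]

/-- The extension `Ω(A) → Ω(A')` of an algebra homomorphism `A → A'`. -/
def omegaMap {A' : Type*} [Ring A'] [Algebra ℂ A'] (f : A →ₐ[ℂ] A') : Hom (omega A) (omega A') :=
  omegaLift (Γ := omega A') ((omegaIn A').comp f) fun a => omegaOf_mem (f a)

theorem omegaMap_of {A' : Type*} [Ring A'] [Algebra ℂ A'] (f : A →ₐ[ℂ] A') (a : A) :
    omegaMap f (omegaIn A a) = omegaIn A' (f a) := omegaLift_of _ _ a

theorem omegaLift_surjective
    (h : Algebra.adjoin ℂ (Set.range f ∪ Set.range fun a => Γ.d (f a)) = ⊤) :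
    Function.Surjective (omegaLift f hf) := by
  rw [← AlgHom.range_eq_top, eq_top_iff, ← h, Algebra.adjoin_le_iff]
  rintro _ (⟨a, rfl⟩ | ⟨a, rfl⟩)
  · exact ⟨omegaIn A a, omegaLift_of f hf a⟩
  · refine ⟨(omega A).d (omegaIn A a), ((omegaLift f hf).comm_d _).trans ?_⟩
    rw [omegaLift_of]

theorem omega_generated :
    Algebra.adjoin ℂ (Set.range (omegaIn A) ∪ Set.range fun a => (omega A).d (omegaIn A a)) = ⊤ := by
  set S := Algebra.adjoin ℂ
    (Set.range (omegaIn A) ∪ Set.range fun a => (omega A).d (omegaIn A a)) with hS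
  rw [eq_top_iff]
  rintro x -
  refine omega_induction (p := fun x => (show omega A from x) ∈ S) x ?_ ?_ ?_ ?_
  · exact fun a => Algebra.subset_adjoin (Or.inl ⟨a, rfl⟩)
  · exact fun a => Algebra.subset_adjoin (Or.inr ⟨a, omegaDiff_of a⟩)
  · exact fun y z hy hz => S.mul_mem hy hz
  · exact fun y z hy hz => S.add_mem hy hz

theorem omegaMap_surjective {A' : Type*} [Ring A'] [Algebra ℂ A'] (f : A →ₐ[ℂ] A')
    (hf : Function.Surjective f) : Function.Surjective (omegaMap f) := by
  apply omegaLift_surjective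
  have h1 : Set.range ((omegaIn A').comp f) = Set.range (omegaIn A') := by
    rw [AlgHom.coe_comp, hf.range_comp]
  have h2 : (Set.range fun a => (omega A').d (((omegaIn A').comp f) a)) =
      Set.range fun a => (omega A').d (omegaIn A' a) :=
    hf.range_comp fun a => (omega A').d (omegaIn A' a)
  rw [h1, h2, omega_generated]

end OmegaMaps

end DiffAlg

namespace DiffAlg

/-! ### Differential algebras over an algebra -/

section Over

variable {A : Type*} [Ring A] [Algebra ℂ A]

/-- `Γ` is a differential algebra over `A`, where `A` is identified with `Γ⁰` by means of `of`. -/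
structure IsOver (Γ : DiffAlg) (of : A →ₐ[ℂ] Γ) : Prop where
  injective : Function.Injective of
  range_eq : ∀ x : Γ, x ∈ Γ.deg 0 ↔ x ∈ of.range

/-- `Γ` is a differential calculus over `A`: it is a differential algebra over `A` which is
generated, as an algebra over `A`, by the `da`, `a ∈ A`. -/
structure IsCalculus (Γ : DiffAlg) (of : A →ₐ[ℂ] Γ) : Prop extends IsOver Γ of where
  generated : Algebra.adjoin ℂ (Set.range of ∪ Set.range fun a => Γ.d (of a)) = ⊤

/-- The degree zero component `K⁰ = K ∩ A` of a differential ideal of a differential algebra over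
`A`. -/
def DiffIdeal.degZero {Γ : DiffAlg} (K : DiffIdeal Γ) (of : A →ₐ[ℂ] Γ) : Ideal A :=
  K.ideal.comap of

instance {Γ : DiffAlg} (K : DiffIdeal Γ) (of : A →ₐ[ℂ] Γ) : (K.degZero of).IsTwoSided :=
  inferInstanceAs (K.ideal.comap of).IsTwoSided

/-- The homomorphism `A/K⁰ → Γ/K` induced by the inclusion `A → Γ`. -/
def DiffIdeal.quotOf {Γ : DiffAlg} (K : DiffIdeal Γ) (of : A →ₐ[ℂ] Γ) :
    (A ⧸ K.degZero of) →ₐ[ℂ] K.quot :=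
  Ideal.Quotient.liftₐ (K.degZero of) (K.toQuot.toAlgHom.comp of) fun _ ha =>
    (K.toQuot_eq_zero _).mpr ha

/-- `Γ`, with the finite family `(Kᵢ)` of differential ideals, is an LC-differential algebra over
`A`: the `Kᵢ` form a covering of `Γ`, the factor differential algebras `Γ/Kᵢ` are differential
calculi over `A/Kᵢ⁰`, and `Kᵢ⁰ ≠ 0` for all `i`. -/
structure IsLC {I : Type*} (Γ : DiffAlg) (of : A →ₐ[ℂ] Γ) (K : I → DiffIdeal Γ) : Prop where
  isOver : IsOver Γ of
  covering : ⨅ i, (K i).ideal = ⊥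
  calculus : ∀ i, IsCalculus (K i).quot ((K i).quotOf of)
  degZero_ne_bot : ∀ i, (K i).degZero of ≠ ⊥

end Over

/-! ### Maps into skew tensor products -/

section SkewMaps

variable (Γ Λ : DiffAlg)

theorem d_one : Γ.d 1 = 0 := by
  have h := Γ.leibniz Γ.one_mem 1
  rw [mul_one, mul_one, one_mul, pow_zero, one_smul] at h
  exact left_eq_add.mp h

/-- The homomorphism `γ ↦ γ ⊗̂ 1`. -/
def skewInl : Hom Γ (skew Γ Λ) where
  toAlgHom := GradedTensorProduct.includeLeft Γ.deg Λ.deg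
  map_deg {n x} hx := by
    have h := stmul_mem hx Λ.one_mem
    rw [add_zero] at h
    exact h
  map_d x := by
    change stmul (Γ.d x) 1 = skewD Γ Λ (stmul x 1)
    induction x using Γ.hom_induction with
    | hom n x hx => rw [skewD_stmul Γ Λ hx, Λ.d_one, stmul_zero, smul_zero, add_zero]
    | zero => rw [map_zero, zero_stmul, map_zero]
    | add y z hy hz => rw [map_add, add_stmul, add_stmul, map_add, hy, hz]

/-- The homomorphism `ρ ↦ 1 ⊗̂ ρ`. -/
def skewInr : Hom Λ (skew Γ Λ) where
  toAlgHom := GradedTensorProduct.includeRight Γ.deg Λ.deg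
  map_deg {n x} hx := by
    have h := stmul_mem Γ.one_mem hx
    rw [zero_add] at h
    exact h
  map_d x := by
    change stmul 1 (Λ.d x) = skewD Γ Λ (stmul 1 x)
    rw [skewD_stmul Γ Λ Γ.one_mem, Γ.d_one, zero_stmul, zero_add, pow_zero, one_smul]

theorem skewInl_mul_skewInr (x : Γ) (y : Λ) :
    skewInl Γ Λ x * skewInr Γ Λ y = (show skew Γ Λ from stmul x y) :=
  GradedTensorProduct.tmul_one_mul_one_tmul (R := ℂ) Γ.deg Λ.deg x y

variable {Γ Λ} {A H : Type*} [Ring A] [Algebra ℂ A] [Ring H] [Algebra ℂ H]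
  (f : A →ₐ[ℂ] Γ) (g : H →ₐ[ℂ] Λ) (hf : ∀ a, f a ∈ Γ.deg 0) (hg : ∀ h, g h ∈ Λ.deg 0)

/-- The homomorphism `A ⊗ H → Γ ⊗̂ Λ`, `a ⊗ h ↦ f(a) ⊗̂ g(h)`, for homomorphisms `f : A → Γ⁰` and
`g : H → Λ⁰`. -/
def skewOf : A ⊗[ℂ] H →ₐ[ℂ] skew Γ Λ :=
  Algebra.TensorProduct.lift ((skewInl Γ Λ).toAlgHom.comp f) ((skewInr Γ Λ).toAlgHom.comp g)
    fun a h => by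
      change skewInl Γ Λ (f a) * skewInr Γ Λ (g h) = skewInr Γ Λ (g h) * skewInl Γ Λ (f a)
      rw [skewInl_mul_skewInr]
      refine Eq.symm ((stmul_mul Γ Λ 1 1 (hg h) (hf a)).trans ?_)
      rw [one_mul, mul_one, mul_zero, pow_zero, one_smul]

theorem skewOf_inl (a : A) : skewOf f g hf hg (a ⊗ₜ 1) = skewInl Γ Λ (f a) := by
  rw [skewOf, Algebra.TensorProduct.lift_tmul, map_one, mul_one]; rfl

theorem skewOf_inr (h : H) : skewOf f g hf hg (1 ⊗ₜ h) = skewInr Γ Λ (g h) := by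
  rw [skewOf, Algebra.TensorProduct.lift_tmul, map_one, one_mul]; rfl

theorem skewOf_mem (x : A ⊗[ℂ] H) : skewOf f g hf hg x ∈ (skew Γ Λ).deg 0 := by
  induction x using TensorProduct.induction_on with
  | zero => rw [map_zero]; exact zero_mem _
  | tmul a h =>
    rw [skewOf, Algebra.TensorProduct.lift_tmul]
    have h := (skew Γ Λ).mul_mem ((skewInl Γ Λ).map_mem (hf a)) ((skewInr Γ Λ).map_mem (hg h))
    rw [add_zero] at h
    exact h
  | add x y hx hy => rw [map_add]; exact add_mem hx hy

/-- The skew tensor product of differential calculi is generated in degree zero. -/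
theorem skew_generated
    (hΓ : Algebra.adjoin ℂ (Set.range f ∪ Set.range fun a => Γ.d (f a)) = ⊤)
    (hΛ : Algebra.adjoin ℂ (Set.range g ∪ Set.range fun a => Λ.d (g a)) = ⊤) :
    Algebra.adjoin ℂ (Set.range (skewOf f g hf hg) ∪
      Set.range fun x => (skew Γ Λ).d (skewOf f g hf hg x)) = ⊤ := by
  set S := Algebra.adjoin ℂ (Set.range (skewOf f g hf hg) ∪
      Set.range fun x => (skew Γ Λ).d (skewOf f g hf hg x)) with hS
  have h1 : ∀ x, skewOf f g hf hg x ∈ S := fun x => Algebra.subset_adjoin (Or.inl ⟨x, rfl⟩)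
  have h2 : ∀ x, (skew Γ Λ).d (skewOf f g hf hg x) ∈ S :=
    fun x => Algebra.subset_adjoin (Or.inr ⟨x, rfl⟩)
  have hl : ∀ x : Γ, skewInl Γ Λ x ∈ S := by
    have : (⊤ : Subalgebra ℂ Γ) ≤ S.comap (skewInl Γ Λ).toAlgHom := by
      rw [← hΓ, Algebra.adjoin_le_iff]
      rintro _ (⟨a, rfl⟩ | ⟨a, rfl⟩)
      · change skewInl Γ Λ (f a) ∈ S
        rw [← skewOf_inl f g hf hg]; exact h1 _
      · change skewInl Γ Λ (Γ.d (f a)) ∈ S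
        rw [Hom.comm_d, ← skewOf_inl f g hf hg]; exact h2 _
    exact fun x => this Algebra.mem_top
  have hr : ∀ x : Λ, skewInr Γ Λ x ∈ S := by
    have : (⊤ : Subalgebra ℂ Λ) ≤ S.comap (skewInr Γ Λ).toAlgHom := by
      rw [← hΛ, Algebra.adjoin_le_iff]
      rintro _ (⟨a, rfl⟩ | ⟨a, rfl⟩)
      · change skewInr Γ Λ (g a) ∈ S
        rw [← skewOf_inr f g hf hg]; exact h1 _
      · change skewInr Γ Λ (Λ.d (g a)) ∈ S
        rw [Hom.comm_d, ← skewOf_inr f g hf hg]; exact h2 _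
    exact fun x => this Algebra.mem_top
  rw [eq_top_iff]
  rintro (x : SkewTensor Γ Λ) -
  induction x using skew_induction with
  | hom m n a _ b _ =>
    have h := S.mul_mem (hl a) (hr b)
    rw [skewInl_mul_skewInr] at h
    exact h
  | zero => exact S.zero_mem
  | add y z hy hz => exact S.add_mem hy hz

end SkewMaps

end DiffAlg

/-- A differential calculus over the algebra `A`. -/
structure Calculus (A : Type*) [Ring A] [Algebra ℂ A] extends DiffAlg where
  of : A →ₐ[ℂ] carrier
  isCalculus : DiffAlg.IsCalculus toDiffAlg of

theorem Calculus.of_mem {A : Type*} [Ring A] [Algebra ℂ A] (Γ : Calculus A) (a : A) :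
    Γ.of a ∈ Γ.deg 0 := (Γ.isCalculus.range_eq _).mpr ⟨a, rfl⟩

/-- The projection `Ω(A) → Γ(A)`, i.e. `id_{Ω → Γ}`. -/
def Calculus.ofOmega {A : Type*} [Ring A] [Algebra ℂ A] (Γ : Calculus A) :
    DiffAlg.Hom (DiffAlg.omega A) Γ.toDiffAlg := DiffAlg.omegaLift Γ.of Γ.of_mem

theorem Calculus.ofOmega_surjective {A : Type*} [Ring A] [Algebra ℂ A] (Γ : Calculus A) :
    Function.Surjective Γ.ofOmega := DiffAlg.omegaLift_surjective _ _ Γ.isCalculus.generated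

/-- A differential calculus `Γ(H)` over a Hopf algebra `H` is right covariant if there is a right
coaction `Δ^Γ : Γ(H) → Γ(H) ⊗ H` making it a right `H`-comodule algebra such that
`Δ^Γ(h₀ dh₁ ⋯ dhₙ) = Δ(h₀) (d ⊗ id)Δ(h₁) ⋯ (d ⊗ id)Δ(hₙ)`. -/
def Calculus.IsRightCovariant {H : Type*} [Ring H] [HopfAlgebra ℂ H] (Γ : Calculus H) : Prop :=
  ∃ δ : Γ.carrier →ₐ[ℂ] Γ.carrier ⊗[ℂ] H,
    ((Algebra.TensorProduct.assoc ℂ ℂ ℂ Γ.carrier H H).toAlgHom.comp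
        (Algebra.TensorProduct.map δ (AlgHom.id ℂ H))).comp δ =
      (Algebra.TensorProduct.map (AlgHom.id ℂ Γ.carrier) (Bialgebra.comulAlgHom ℂ H)).comp δ ∧
    ((Algebra.TensorProduct.rid ℂ ℂ Γ.carrier).toAlgHom.comp
        (Algebra.TensorProduct.map (AlgHom.id ℂ Γ.carrier) (Bialgebra.counitAlgHom ℂ H))).comp δ =
      AlgHom.id ℂ Γ.carrier ∧
    ∀ (h₀ : H) (l : List H),
      δ (Γ.of h₀ * (l.map fun h => Γ.d (Γ.of h)).prod) =
        TensorProduct.map Γ.of.toLinearMap LinearMap.id (Coalgebra.comul (R := ℂ) h₀) *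
          (l.map fun h => TensorProduct.map (Γ.d ∘ₗ Γ.of.toLinearMap) LinearMap.id
            (Coalgebra.comul (R := ℂ) h)).prod

/-- A finite family of ideals `(Jᵢ)` of the algebra `A` is a complete covering if `⋂ᵢ Jᵢ = 0` and
the canonical embedding `a ↦ (a + Jᵢ)ᵢ` of `A` into the covering completion
`{(bᵢ) ∈ ⨁ᵢ A/Jᵢ | bᵢ = bⱼ in A/(Jᵢ + Jⱼ)}` is surjective. -/
structure IsCompleteCovering {I A : Type*} [Ring A] (J : I → Ideal A) : Prop where
  iInf_eq_bot : ⨅ i, J i = ⊥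
  complete : ∀ b : ∀ i, A ⧸ J i,
    (∀ i j, Submodule.factor (le_sup_left : J i ≤ J i ⊔ J j) (b i) =
      Submodule.factor (le_sup_right : J j ≤ J i ⊔ J j) (b j)) →
    ∃ a : A, ∀ i, b i = Submodule.Quotient.mk a

/-- A locally trivial quantum principal fibre bundle with base algebra `B` covered by the ideals
`J i`, structure Hopf algebra `H` and total space algebra `P`. -/
structure QPFB {I : Type*} (B H P : Type*) [Ring B] [Algebra ℂ B] [Ring H] [HopfAlgebra ℂ H]
    [Ring P] [Algebra ℂ P] (J : I → Ideal B) [∀ i, (J i).IsTwoSided] where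
  /-- the right coaction `Δ_P` of `H` on `P` -/
  coaction : P →ₐ[ℂ] P ⊗[ℂ] H
  coassoc : ((Algebra.TensorProduct.assoc ℂ ℂ ℂ P H H).toAlgHom.comp
      (Algebra.TensorProduct.map coaction (AlgHom.id ℂ H))).comp coaction =
    (Algebra.TensorProduct.map (AlgHom.id ℂ P) (Bialgebra.comulAlgHom ℂ H)).comp coaction
  counit : ((Algebra.TensorProduct.rid ℂ ℂ P).toAlgHom.comp
      (Algebra.TensorProduct.map (AlgHom.id ℂ P) (Bialgebra.counitAlgHom ℂ H))).comp coaction =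
    AlgHom.id ℂ P
  /-- the local trivializations -/
  χ : ∀ i, P →ₐ[ℂ] (B ⧸ J i) ⊗[ℂ] H
  /-- the embedding of the base algebra -/
  ι : B →ₐ[ℂ] P
  χ_surjective : ∀ i, Function.Surjective (χ i)
  ι_injective : Function.Injective ι
  χ_coaction : ∀ i,
    (Algebra.TensorProduct.map (AlgHom.id ℂ (B ⧸ J i)) (Bialgebra.comulAlgHom ℂ H)).comp (χ i) =
      ((Algebra.TensorProduct.assoc ℂ ℂ ℂ (B ⧸ J i) H H).toAlgHom.comp
        (Algebra.TensorProduct.map (χ i) (AlgHom.id ℂ H))).comp coaction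
  χ_ι : ∀ i a, χ i (ι a) = Ideal.Quotient.mk (J i) a ⊗ₜ 1
  base_covering : IsCompleteCovering J
  total_covering : IsCompleteCovering fun i => RingHom.ker (χ i)
  range_ι : ∀ f, f ∈ ι.range ↔ coaction f = f ⊗ₜ 1

namespace QPFB

open DiffAlg

variable {I : Type*} {B H P : Type*} [Ring B] [Algebra ℂ B] [Ring H] [HopfAlgebra ℂ H]
  [Ring P] [Algebra ℂ P] {J : I → Ideal B} [∀ i, (J i).IsTwoSided] (E : QPFB B H P J)
  (Γ : ∀ i, Calculus (B ⧸ J i)) (ΓH : Calculus H)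

/-! ### The differential structure on the bundle -/

/-- The differential calculus `Γ(Bᵢ) ⊗̂ Γ(H)` over `Bᵢ ⊗ H`. -/
def trivCalc (_ : QPFB B H P J) (i : I) : DiffAlg := skew (Γ i).toDiffAlg ΓH.toDiffAlg

/-- The inclusion `Bᵢ ⊗ H → Γ(Bᵢ) ⊗̂ Γ(H)`. -/
def trivOf (i : I) : (B ⧸ J i) ⊗[ℂ] H →ₐ[ℂ] E.trivCalc Γ ΓH i :=
  skewOf (Γ i).of ΓH.of (Γ i).of_mem ΓH.of_mem

theorem trivOf_mem (i : I) (x : (B ⧸ J i) ⊗[ℂ] H) :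
    E.trivOf Γ ΓH i x ∈ (E.trivCalc Γ ΓH i).deg 0 :=
  skewOf_mem _ _ _ _ x

/-- The homomorphism `γ ↦ γ ⊗̂ 1` from `Γ(Bᵢ)` to `Γ(Bᵢ) ⊗̂ Γ(H)`. -/
def trivInl (i : I) : Hom (Γ i).toDiffAlg (E.trivCalc Γ ΓH i) := skewInl _ _

theorem trivOf_inl (i : I) (b : B ⧸ J i) :
    E.trivOf Γ ΓH i (b ⊗ₜ 1) = E.trivInl Γ ΓH i ((Γ i).of b) := skewOf_inl _ _ _ _ b

/-- The extension `χᵢ_{Ω → Γ} : Ω(P) → Γ(Bᵢ) ⊗̂ Γ(H)` of `χᵢ`. -/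
def χΩ (i : I) : Hom (omega P) (E.trivCalc Γ ΓH i) :=
  omegaLift ((E.trivOf Γ ΓH i).comp (E.χ i)) fun p => E.trivOf_mem Γ ΓH i (E.χ i p)

/-- The differential ideal `J(P) = ⋂ᵢ ker χᵢ_{Ω → Γ}`. -/
def idealP : DiffIdeal (omega P) := DiffIdeal.inf fun i => DiffIdeal.ker (E.χΩ Γ ΓH i)

/-- The differential structure `Γ(P) = Ω(P)/J(P)` on the bundle determined by the differential
calculi `Γ(Bᵢ)` and `Γ(H)`. -/
def ΓP : DiffAlg := (E.idealP Γ ΓH).quot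

/-- The projection `Ω(P) → Γ(P)`. -/
def toΓP : Hom (omega P) (E.ΓP Γ ΓH) := (E.idealP Γ ΓH).toQuot

/-- The inclusion `P → Γ(P)`. -/
def ofP : P →ₐ[ℂ] E.ΓP Γ ΓH := (E.toΓP Γ ΓH).toAlgHom.comp (omegaIn P)

/-- The extension `χᵢ_Γ : Γ(P) → Γ(Bᵢ) ⊗̂ Γ(H)` of `χᵢ`. -/
def χΓ (i : I) : Hom (E.ΓP Γ ΓH) (E.trivCalc Γ ΓH i) :=
  (E.idealP Γ ΓH).lift (E.χΩ Γ ΓH i) fun _ hx => (Submodule.mem_iInf _).mp hx i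

theorem χΓ_ofP (i : I) (p : P) : E.χΓ Γ ΓH i (E.ofP Γ ΓH p) = E.trivOf Γ ΓH i (E.χ i p) :=
  omegaLift_of _ _ p

theorem χΓ_surjective (i : I) : Function.Surjective (E.χΓ Γ ΓH i) := by
  have h : Function.Surjective (E.χΩ Γ ΓH i) := by
    apply omegaLift_surjective
    have hr : Set.range ((E.trivOf Γ ΓH i).comp (E.χ i)) = Set.range (E.trivOf Γ ΓH i) := by
      rw [AlgHom.coe_comp, (E.χ_surjective i).range_comp]
    have hr' : (Set.range fun p => (E.trivCalc Γ ΓH i).d (((E.trivOf Γ ΓH i).comp (E.χ i)) p)) =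
        Set.range fun x => (E.trivCalc Γ ΓH i).d (E.trivOf Γ ΓH i x) :=
      (E.χ_surjective i).range_comp fun x => (E.trivCalc Γ ΓH i).d (E.trivOf Γ ΓH i x)
    rw [hr, hr']
    exact skew_generated _ _ _ _ (Γ i).isCalculus.generated ΓH.isCalculus.generated
  intro y
  obtain ⟨x, rfl⟩ := h y
  exact ⟨(E.idealP Γ ΓH).toQuot x, rfl⟩

section Completion

variable [Finite I]

/-- The covering completion `Γ_c(P)` of `Γ(P)` with respect to the covering `(ker χᵢ_Γ)ᵢ`. -/
def ΓcP : DiffAlg := completion (E.ΓP Γ ΓH) fun i => DiffIdeal.ker (E.χΓ Γ ΓH i)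

/-- The canonical homomorphism `P → Γ_c(P)`. -/
def ofPc : P →ₐ[ℂ] E.ΓcP Γ ΓH :=
  (toCompletion (E.ΓP Γ ΓH) fun i => DiffIdeal.ker (E.χΓ Γ ΓH i)).toAlgHom.comp (E.ofP Γ ΓH)

/-- The extension `χᵢ_{Γ_c} : Γ_c(P) → Γ(Bᵢ) ⊗̂ Γ(H)` of `χᵢ`: the `i`-th projection, followed by
the isomorphism `Γ(P)/ker χᵢ_Γ ≅ Γ(Bᵢ) ⊗̂ Γ(H)` induced by `χᵢ_Γ`. -/
def χΓc (i : I) : Hom (E.ΓcP Γ ΓH) (E.trivCalc Γ ΓH i) :=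
  ((DiffIdeal.ker (E.χΓ Γ ΓH i)).lift (E.χΓ Γ ΓH i) fun _ hx => hx).comp
    (completionProj (E.ΓP Γ ΓH) (fun i => DiffIdeal.ker (E.χΓ Γ ΓH i)) i)

end Completion

/-! ### The overlap calculi and `Γ_m(B)` -/

instance (i j : I) : (J i ⊔ J j).IsTwoSided := DiffIdeal.sup_isTwoSided _ _

/-- The ideal `χᵢ_Γ(ker χⱼ_Γ)` of `Γ(Bᵢ) ⊗̂ Γ(H)`. -/
def overlapIdeal (i j : I) : DiffIdeal (E.trivCalc Γ ΓH i) :=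
  (DiffIdeal.ker (E.χΓ Γ ΓH j)).map (E.χΓ Γ ΓH i) (E.χΓ_surjective Γ ΓH i)

/-- The differential calculus `Γⁱ(Bᵢⱼ ⊗ H) = (Γ(Bᵢ) ⊗̂ Γ(H))/χᵢ_Γ(ker χⱼ_Γ)`. -/
def overlapCalc (i j : I) : DiffAlg := (E.overlapIdeal Γ ΓH i j).quot

/-- The projection `Γ(Bᵢ) ⊗̂ Γ(H) → Γⁱ(Bᵢⱼ ⊗ H)`. -/
def toOverlap (i j : I) : Hom (E.trivCalc Γ ΓH i) (E.overlapCalc Γ ΓH i j) :=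
  (E.overlapIdeal Γ ΓH i j).toQuot

theorem toOverlap_χΓ (i j : I) (x : E.ΓP Γ ΓH) (hx : E.χΓ Γ ΓH j x = 0) :
    E.toOverlap Γ ΓH i j (E.χΓ Γ ΓH i x) = 0 :=
  (DiffIdeal.toQuot_eq_zero _ _).mpr (Ideal.mem_map_of_mem (E.χΓ Γ ΓH i).toAlgHom hx)

theorem overlap_vanish (i j : I) {b : B} (hb : b ∈ J i ⊔ J j) :
    E.toOverlap Γ ΓH i j
      (E.trivOf Γ ΓH i (Ideal.Quotient.mk (J i) b ⊗ₜ 1)) = 0 := by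
  obtain ⟨x, hx, y, hy, rfl⟩ := Submodule.mem_sup.mp hb
  have hx' : Ideal.Quotient.mk (J i) x = 0 := Ideal.Quotient.eq_zero_iff_mem.mpr hx
  have hy' : Ideal.Quotient.mk (J j) y = 0 := Ideal.Quotient.eq_zero_iff_mem.mpr hy
  rw [map_add, hx', zero_add, ← E.χ_ι, ← E.χΓ_ofP]
  apply E.toOverlap_χΓ
  rw [E.χΓ_ofP, E.χ_ι, hy', TensorProduct.zero_tmul, map_zero]

/-- The canonical homomorphism `Bᵢⱼ → Γⁱ(Bᵢⱼ ⊗ H)`, `b + Jᵢ + Jⱼ ↦ [(b + Jᵢ) ⊗̂ 1]`. -/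
def overlapInl (i j : I) : (B ⧸ (J i ⊔ J j)) →ₐ[ℂ] E.overlapCalc Γ ΓH i j :=
  Ideal.Quotient.liftₐ (J i ⊔ J j)
    (((E.toOverlap Γ ΓH i j).toAlgHom.comp (E.trivOf Γ ΓH i)).comp
      (Algebra.TensorProduct.includeLeft.comp (Ideal.Quotient.mkₐ ℂ (J i))))
    fun _ hb => E.overlap_vanish Γ ΓH i j hb

/-- The canonical homomorphism `H → Γⁱ(Bᵢⱼ ⊗ H)`, `h ↦ [1 ⊗̂ h]`. -/
def overlapInr (i j : I) : H →ₐ[ℂ] E.overlapCalc Γ ΓH i j :=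
  ((E.toOverlap Γ ΓH i j).toAlgHom.comp (E.trivOf Γ ΓH i)).comp
    Algebra.TensorProduct.includeRight

/-- The canonical homomorphism `Bᵢⱼ ⊗ H → Γⁱ(Bᵢⱼ ⊗ H)`, `πᵢⱼ(b) ⊗ h ↦ [πᵢ(b) ⊗̂ h]`. -/
def overlapOf (i j : I) : (B ⧸ (J i ⊔ J j)) ⊗[ℂ] H →ₐ[ℂ] E.overlapCalc Γ ΓH i j :=
  Algebra.TensorProduct.lift (E.overlapInl Γ ΓH i j) (E.overlapInr Γ ΓH i j) fun b h => by
    obtain ⟨b, rfl⟩ := Ideal.Quotient.mk_surjective b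
    let F := (E.toOverlap Γ ΓH i j).toAlgHom.comp (E.trivOf Γ ΓH i)
    change F (Ideal.Quotient.mk (J i) b ⊗ₜ 1) * F (1 ⊗ₜ h) =
      F (1 ⊗ₜ h) * F (Ideal.Quotient.mk (J i) b ⊗ₜ 1)
    rw [← map_mul, ← map_mul, Algebra.TensorProduct.tmul_mul_tmul,
      Algebra.TensorProduct.tmul_mul_tmul, one_mul, one_mul, mul_one, mul_one]

theorem overlapOf_tmul (i j : I) (b : B) (h : H) :
    E.overlapOf Γ ΓH i j (Ideal.Quotient.mk (J i ⊔ J j) b ⊗ₜ h) =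
      E.toOverlap Γ ΓH i j
        (E.trivOf Γ ΓH i (Ideal.Quotient.mk (J i) b ⊗ₜ h)) := by
  rw [overlapOf, Algebra.TensorProduct.lift_tmul]
  let F := (E.toOverlap Γ ΓH i j).toAlgHom.comp (E.trivOf Γ ΓH i)
  change F (Ideal.Quotient.mk (J i) b ⊗ₜ 1) * F (1 ⊗ₜ h) = F (Ideal.Quotient.mk (J i) b ⊗ₜ h)
  rw [← map_mul, Algebra.TensorProduct.tmul_mul_tmul, one_mul, mul_one]

theorem overlapOf_mem (i j : I) (x : (B ⧸ (J i ⊔ J j)) ⊗[ℂ] H) :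
    E.overlapOf Γ ΓH i j x ∈ (E.overlapCalc Γ ΓH i j).deg 0 := by
  induction x using TensorProduct.induction_on with
  | zero => rw [map_zero]; exact zero_mem _
  | tmul b h =>
    obtain ⟨b, rfl⟩ := Ideal.Quotient.mk_surjective b
    rw [overlapOf_tmul]
    exact Hom.map_mem _ (E.trivOf_mem Γ ΓH i _)
  | add x y hx hy => rw [map_add]; exact add_mem hx hy

/-- The differential ideal `Jⁱ(Bᵢⱼ ⊗ H) ⊂ Ω(Bᵢⱼ ⊗ H)` corresponding to the differential calculus
`Γⁱ(Bᵢⱼ ⊗ H)`. -/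
def idealBijH (i j : I) : DiffIdeal (omega ((B ⧸ (J i ⊔ J j)) ⊗[ℂ] H)) :=
  DiffIdeal.ker (omegaLift (E.overlapOf Γ ΓH i j) (E.overlapOf_mem Γ ΓH i j))

/-- The differential ideal `J_m(Bᵢⱼ) = Jⁱ(Bᵢⱼ) = Jⁱ(Bᵢⱼ ⊗ H) ∩ Ω(Bᵢⱼ ⊗ 1)` of `Ω(Bᵢⱼ)`. -/
def idealBij (i j : I) : DiffIdeal (omega (B ⧸ (J i ⊔ J j))) :=
  (E.idealBijH Γ ΓH i j).comap (omegaMap Algebra.TensorProduct.includeLeft)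

/-- The differential calculus `Γ_m(Bᵢⱼ) = Ω(Bᵢⱼ)/J_m(Bᵢⱼ)`. -/
def ΓmBij (i j : I) : DiffAlg := (E.idealBij Γ ΓH i j).quot

/-- The projection `Ω(Bᵢⱼ) → Γ_m(Bᵢⱼ)`. -/
def toΓmBij (i j : I) : Hom (omega (B ⧸ (J i ⊔ J j))) (E.ΓmBij Γ ΓH i j) :=
  (E.idealBij Γ ΓH i j).toQuot

/-- The projection `πⁱⱼ : Bᵢ → Bᵢⱼ`. -/
def πl (_ : QPFB B H P J) (i j : I) : (B ⧸ J i) →ₐ[ℂ] (B ⧸ (J i ⊔ J j)) :=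
  Ideal.Quotient.liftₐ (J i) (Ideal.Quotient.mkₐ ℂ (J i ⊔ J j)) fun _ hb =>
    Ideal.Quotient.eq_zero_iff_mem.mpr (Ideal.mem_sup_left hb)

/-- The projection `πʲᵢ : Bⱼ → Bᵢⱼ`. -/
def πr (_ : QPFB B H P J) (i j : I) : (B ⧸ J j) →ₐ[ℂ] (B ⧸ (J i ⊔ J j)) :=
  Ideal.Quotient.liftₐ (J j) (Ideal.Quotient.mkₐ ℂ (J i ⊔ J j)) fun _ hb =>
    Ideal.Quotient.eq_zero_iff_mem.mpr (Ideal.mem_sup_right hb)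

/-- The composition `Ω(Bᵢⱼ) → Ω(Bᵢⱼ ⊗ H) → Γⁱ(Bᵢⱼ ⊗ H)`, with kernel `J_m(Bᵢⱼ)`. -/
def overlapΩ (i j : I) : Hom (omega (B ⧸ (J i ⊔ J j))) (E.overlapCalc Γ ΓH i j) :=
  (omegaLift (E.overlapOf Γ ΓH i j) (E.overlapOf_mem Γ ΓH i j)).comp
    (omegaMap Algebra.TensorProduct.includeLeft)

theorem overlapΩ_of (i j : I) (b : B) :
    E.overlapΩ Γ ΓH i j (omegaIn _ (Ideal.Quotient.mk (J i ⊔ J j) b)) =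
      E.toOverlap Γ ΓH i j
        (E.trivOf Γ ΓH i (Ideal.Quotient.mk (J i) b ⊗ₜ 1)) := by
  rw [overlapΩ, Hom.comp_apply, omegaMap_of, omegaLift_of]
  exact E.overlapOf_tmul Γ ΓH i j b 1

theorem πmL_aux (i j : I) (x : omega (B ⧸ J i)) (hx : (Γ i).ofOmega x = 0) :
    ((E.toΓmBij Γ ΓH i j).comp (omegaMap (E.πl i j))) x = 0 := by
  refine (DiffIdeal.toQuot_eq_zero _ _).mpr ?_
  change (E.overlapΩ Γ ΓH i j).comp (omegaMap (E.πl i j)) x = 0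
  have key := omega_hom_ext (f := (E.overlapΩ Γ ΓH i j).comp (omegaMap (E.πl i j)))
    (g := (E.toOverlap Γ ΓH i j).comp ((E.trivInl Γ ΓH i).comp (Γ i).ofOmega))
    (fun b => by
      obtain ⟨b, rfl⟩ := Ideal.Quotient.mk_surjective b
      rw [Hom.comp_apply, omegaMap_of]
      refine (E.overlapΩ_of Γ ΓH i j b).trans ?_
      rw [E.trivOf_inl, Hom.comp_apply, Hom.comp_apply, Calculus.ofOmega, omegaLift_of]) x
  rw [key, Hom.comp_apply, Hom.comp_apply, hx, map_zero, map_zero]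

theorem πmR_aux (i j : I) (x : omega (B ⧸ J j)) (hx : (Γ j).ofOmega x = 0) :
    ((E.toΓmBij Γ ΓH i j).comp (omegaMap (E.πr i j))) x = 0 := by
  refine (DiffIdeal.toQuot_eq_zero _ _).mpr ?_
  change (E.overlapΩ Γ ΓH i j).comp (omegaMap (E.πr i j)) x = 0
  obtain ⟨y, rfl⟩ := omegaMap_surjective _ (Ideal.Quotient.mkₐ_surjective ℂ (J j)) x
  let z : E.ΓP Γ ΓH := E.toΓP Γ ΓH (omegaMap E.ι y)
  have h1 : E.χΓ Γ ΓH j z = 0 := by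
    have key := omega_hom_ext
      (f := (E.χΓ Γ ΓH j).comp ((E.toΓP Γ ΓH).comp (omegaMap E.ι)))
      (g := (E.trivInl Γ ΓH j).comp
        ((Γ j).ofOmega.comp (omegaMap (Ideal.Quotient.mkₐ ℂ (J j)))))
      (fun b => by
        rw [Hom.comp_apply, Hom.comp_apply, omegaMap_of, Hom.comp_apply, Hom.comp_apply,
          omegaMap_of, Calculus.ofOmega, omegaLift_of, ← E.trivOf_inl]
        exact (E.χΓ_ofP Γ ΓH j (E.ι b)).trans (congrArg _ (E.χ_ι j b))) y
    refine key.trans ?_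
    rw [Hom.comp_apply, Hom.comp_apply, hx, map_zero]
  have h2 : E.toOverlap Γ ΓH i j (E.χΓ Γ ΓH i z) = 0 := E.toOverlap_χΓ Γ ΓH i j z h1
  refine Eq.trans ?_ h2
  exact omega_hom_ext
    (f := ((E.overlapΩ Γ ΓH i j).comp (omegaMap (E.πr i j))).comp
      (omegaMap (Ideal.Quotient.mkₐ ℂ (J j))))
    (g := (E.toOverlap Γ ΓH i j).comp ((E.χΓ Γ ΓH i).comp
      ((E.toΓP Γ ΓH).comp (omegaMap E.ι))))
    (fun b => by
      rw [Hom.comp_apply, Hom.comp_apply, omegaMap_of, omegaMap_of]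
      refine (E.overlapΩ_of Γ ΓH i j b).trans ?_
      rw [Hom.comp_apply, Hom.comp_apply, Hom.comp_apply, omegaMap_of, ← E.χ_ι]
      exact congrArg _ (E.χΓ_ofP Γ ΓH i (E.ι b)).symm) y

/-- The extension `πⁱⱼ_{Γ_m} : Γ(Bᵢ) → Γ_m(Bᵢⱼ)` of `πⁱⱼ`. -/
def πmL (i j : I) : Hom (Γ i).toDiffAlg (E.ΓmBij Γ ΓH i j) :=
  (Γ i).ofOmega.factor (Γ i).ofOmega_surjective
    ((E.toΓmBij Γ ΓH i j).comp (omegaMap (E.πl i j))) (E.πmL_aux Γ ΓH i j)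

/-- The extension `πʲᵢ_{Γ_m} : Γ(Bⱼ) → Γ_m(Bᵢⱼ)` of `πʲᵢ`. -/
def πmR (i j : I) : Hom (Γ j).toDiffAlg (E.ΓmBij Γ ΓH i j) :=
  (Γ j).ofOmega.factor (Γ j).ofOmega_surjective
    ((E.toΓmBij Γ ΓH i j).comp (omegaMap (E.πr i j))) (E.πmR_aux Γ ΓH i j)

theorem πmL_of (i j : I) (b : B ⧸ J i) :
    E.πmL Γ ΓH i j ((Γ i).of b) = E.toΓmBij Γ ΓH i j (omegaIn _ (E.πl i j b)) := by
  rw [← omegaLift_of (Γ i).of (Γ i).of_mem b]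
  refine ((Γ i).ofOmega.factor_apply _ _ (E.πmL_aux Γ ΓH i j) _).trans ?_
  rw [Hom.comp_apply, omegaMap_of]

theorem πmR_of (i j : I) (b : B ⧸ J j) :
    E.πmR Γ ΓH i j ((Γ j).of b) = E.toΓmBij Γ ΓH i j (omegaIn _ (E.πr i j b)) := by
  rw [← omegaLift_of (Γ j).of (Γ j).of_mem b]
  refine ((Γ j).ofOmega.factor_apply _ _ (E.πmR_aux Γ ΓH i j) _).trans ?_
  rw [Hom.comp_apply, omegaMap_of]

section Gluing

variable [Finite I]

/-- `Γ_m(B) = {(γᵢ)ᵢ ∈ ⨁ᵢ Γ(Bᵢ) | πⁱⱼ_{Γ_m}(γᵢ) = πʲᵢ_{Γ_m}(γⱼ)}`. -/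
def Γm : DiffAlg :=
  gluing (fun i => (Γ i).toDiffAlg) (E.ΓmBij Γ ΓH) (E.πmL Γ ΓH) (E.πmR Γ ΓH)

/-- The homomorphism `B → Γ_m(B)`, `b ↦ (πᵢ(b))ᵢ`. -/
def ofΓm : B →ₐ[ℂ] E.Γm Γ ΓH :=
  AlgHom.codRestrict (AlgHom.pi fun i => (Γ i).of.comp (Ideal.Quotient.mkₐ ℂ (J i)))
    (gluingAlgebra (fun i => (Γ i).toDiffAlg) (E.ΓmBij Γ ΓH) (E.πmL Γ ΓH) (E.πmR Γ ΓH))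
    fun b i j => by
      change E.πmL Γ ΓH i j ((Γ i).of (Ideal.Quotient.mk (J i) b)) =
        E.πmR Γ ΓH i j ((Γ j).of (Ideal.Quotient.mk (J j) b))
      rw [πmL_of, πmR_of]
      rfl

/-- The projection `Γ_m(B) → Γ(Bᵢ)`, `(γₖ)ₖ ↦ γᵢ`. -/
def πm (i : I) : Hom (E.Γm Γ ΓH) (Γ i).toDiffAlg := gluingProj _ _ _ _ i

/-- `Γg`, with the inclusion `of : B → Γg⁰` and the projections `πᵢ : Γg → Γ(Bᵢ)`, is an
LC-differential algebra over `B` which is embeddable into `Γ_c(P)`: it is an LC-differential algebra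
with respect to the differential ideals `ker πᵢ`, its local differential calculi are the `Γ(Bᵢ)` (by
means of the isomorphisms `Γg/ker πᵢ ≅ Γ(Bᵢ)` induced by the extensions `πᵢ` of the canonical
projections `B → Bᵢ`), and there is an extension `ι_Γg : Γg → Γ_c(P)` of `ι : B → P` such that
`χᵢ_{Γ_c}(ι_Γg(γ)) = πᵢ(γ) ⊗̂ 1`. -/
structure IsEmbeddable (Γg : DiffAlg) (of : B →ₐ[ℂ] Γg)
    (π : ∀ i, Hom Γg (Γ i).toDiffAlg) : Prop where
  isLC : IsLC Γg of fun i => DiffIdeal.ker (π i)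
  π_surjective : ∀ i, Function.Surjective (π i)
  π_of : ∀ i b, π i (of b) = (Γ i).of (Ideal.Quotient.mk (J i) b)
  embedding : ∃ ιg : Hom Γg (E.ΓcP Γ ΓH),
    (∀ b, ιg (of b) = E.ofPc Γ ΓH (E.ι b)) ∧
    ∀ i γ, E.χΓc Γ ΓH i (ιg γ) = E.trivInl Γ ΓH i (π i γ)

end Gluing

end QPFB

end

/-! Write `Kᵢ` for the kernel of `χᵢ_Γ` on `Γ(P)`. Since `χᵢ_Γ` is surjective, `Γⁱ(Bᵢⱼ ⊗ H)` is
`Γ(P)/(Kᵢ + Kⱼ)` in disguise, and `Γ_m(Bᵢⱼ)` is the image of `Ω(Bᵢⱼ)` in it. The restriction maps of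
`Γ_m` therefore test exactly what the gluing condition of `Γ_c(P)` tests: a family `(γᵢ)` lies in
`Γ_m(B)` if and only if the family `(γᵢ ⊗̂ 1)`, read in the `Γ(P)/Kᵢ`, lies in `Γ_c(P)`.

To make this precise, every form on `Bᵢ` is lifted to `Ω(B)` by `baseΩ`, and `Ω(B)` is mapped to
`Γ(P)` by `ιΩ`. In the `i`-th trivialization the pull-back of `u` is `baseΩ u ⊗̂ 1` (`χΓ_ιΩ`). The
pivot is `πm_baseΩ_eq_iff`: lifts `u`, `v` give forms agreeing on the overlap if and only if `ιΩ u -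
ιΩ v ∈ Kᵢ + Kⱼ`. One direction yields the embedding `ιm` of `Γ_m(B)`. The other yields maximality:
the local components of an element of an embeddable algebra are compatible
(`πm_compatible_of_isEmbeddable`), and the resulting map to `Γ_m(B)` is injective because the
kernels of the projections form a covering.

It remains to see that `Γ_m(B)` has nothing but `B` in degree zero (`isOver_Γm`). A compatible
family of functions `bᵢ` gives `ι(bᵢ) - ι(bⱼ) ∈ Kᵢ + Kⱼ`. Passing to degree zero components puts
this difference in `ker χᵢ + ker χⱼ` inside `P` (`mem_ker_sup_ker_of_ofP_mem`). Completeness of the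
covering of `P` then provides `p` with `χᵢ(p) = bᵢ ⊗ 1` for all `i`. Such a `p` is coinvariant,
hence in the image of `B` (`exists_glue`). -/

noncomputable section

/-! ### General facts on differential algebras: degree zero, gluings, quotients, skew tensor
products -/

namespace DiffAlg

theorem exists_omegaOf_eq_of_mem_omegaDeg_zero (A : Type*) [Ring A] [Algebra ℂ A] {x : OmegaAlg A}
    (hx : x ∈ omegaDeg A 0) : ∃ a, omegaOf A a = x := by
  -- The induction runs over all degrees, so the claim is made vacuous outside degree zero. A
  -- product of degree zero has both factors of degree zero, which is why the multiplicative step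
  -- closes.
  have h := omega_homog_induction hx
    (fun n => if n = 0 then (omegaOf A).toLinearMap.range else ⊤)
    (fun a => by rw [if_pos rfl]; exact ⟨a, rfl⟩) (fun a => trivial) fun m n x y _ _ hx hy => by
      by_cases hmn : m + n = 0
      · obtain ⟨rfl, rfl⟩ := Nat.add_eq_zero_iff.mp hmn
        simp only [if_true] at hx hy ⊢
        obtain ⟨a, rfl⟩ := hx
        obtain ⟨b, rfl⟩ := hy
        exact ⟨a * b, map_mul (omegaOf A) a b⟩
      · rw [if_neg hmn]; trivial
  rw [if_pos rfl] at h
  exact h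

/-- The homomorphism into a gluing given by compatible homomorphisms into the pieces. -/
def gluingLift {I : Type*} [Finite I] {Γ : I → DiffAlg} {Λ : I → I → DiffAlg}
    {p : ∀ i j, Hom (Γ i) (Λ i j)} {q : ∀ i j, Hom (Γ j) (Λ i j)} {Θ : DiffAlg}
    (f : ∀ i, Hom Θ (Γ i)) (hf : ∀ i j x, p i j (f i x) = q i j (f j x)) :
    Hom Θ (gluing Γ Λ p q) where
  toAlgHom := AlgHom.codRestrict (AlgHom.pi fun i => (f i).toAlgHom) (gluingAlgebra Γ Λ p q)
    fun x i j => hf i j x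
  map_deg hx i := (f i).map_mem hx
  map_d x := Subtype.ext (funext fun i => (f i).comm_d x)

theorem gluing_ext {I : Type*} [Finite I] {Γ : I → DiffAlg} {Λ : I → I → DiffAlg}
    {p : ∀ i j, Hom (Γ i) (Λ i j)} {q : ∀ i j, Hom (Γ j) (Λ i j)} {x y : gluing Γ Λ p q}
    (h : ∀ i, gluingProj Γ Λ p q i x = gluingProj Γ Λ p q i y) : x = y :=
  Subtype.ext (funext h)

theorem toQuot_eq_iff {Γ : DiffAlg} (K : DiffIdeal Γ) {x y : Γ} :
    K.toQuot x = K.toQuot y ↔ x - y ∈ K.ideal := by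
  rw [← K.toQuot_eq_zero, map_sub, sub_eq_zero]

/-- If `f : Γ → Λ` is a homomorphism from a differential algebra over `A` such that `Λ` is generated
by the `f(a)` and `d(f(a))`, `a ∈ A`, then `Γ/ker f` is a differential calculus over `A/(ker f)⁰`. -/
theorem isCalculus_quot_ker {A : Type*} [Ring A] [Algebra ℂ A] {Γ Λ : DiffAlg} {of : A →ₐ[ℂ] Γ}
    (hof : IsOver Γ of) (f : Hom Γ Λ)
    (hf : Algebra.adjoin ℂ (Set.range (fun a => f (of a)) ∪
      Set.range fun a => Λ.d (f (of a))) = ⊤) :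
    IsCalculus (DiffIdeal.ker f).quot ((DiffIdeal.ker f).quotOf of) where
  injective := by
    rw [injective_iff_map_eq_zero]
    intro a ha
    obtain ⟨a, rfl⟩ := Ideal.Quotient.mk_surjective a
    exact Ideal.Quotient.eq_zero_iff_mem.mpr (((DiffIdeal.ker f).toQuot_eq_zero _).mp ha)
  range_eq x := by
    constructor
    · rintro ⟨y, hy, rfl⟩
      obtain ⟨a, rfl⟩ := (hof.range_eq y).mp hy
      exact ⟨Ideal.Quotient.mk _ a, rfl⟩
    · rintro ⟨a, rfl⟩
      obtain ⟨a, rfl⟩ := Ideal.Quotient.mk_surjective a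
      exact ⟨of a, (hof.range_eq _).mpr ⟨a, rfl⟩, rfl⟩
  generated := by
    set K := DiffIdeal.ker f
    let F : Hom K.quot Λ := K.lift f fun _ hx => hx
    have hF : Function.Injective F := by
      rw [injective_iff_map_eq_zero]
      intro x hx
      obtain ⟨x, rfl⟩ := K.toQuot_surjective x
      exact (K.toQuot_eq_zero x).mpr hx
    set S := Algebra.adjoin ℂ (Set.range (K.quotOf of) ∪
      Set.range fun a => K.quot.d (K.quotOf of a)) with hS
    -- Generation is known in `Λ`, so it is transported back: the image of `S` under the injective
    -- map `F` is everything, and injectivity then forces `S` itself to be everything.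
    have hle : (⊤ : Subalgebra ℂ Λ) ≤ S.map F.toAlgHom := by
      rw [← hf, Algebra.adjoin_le_iff]
      rintro _ (⟨a, rfl⟩ | ⟨a, rfl⟩)
      · exact ⟨K.quotOf of (Ideal.Quotient.mk _ a),
          Algebra.subset_adjoin (Or.inl ⟨Ideal.Quotient.mk _ a, rfl⟩), rfl⟩
      · exact ⟨K.quot.d (K.quotOf of (Ideal.Quotient.mk _ a)),
          Algebra.subset_adjoin (Or.inr ⟨Ideal.Quotient.mk _ a, rfl⟩), F.comm_d _⟩
    rw [eq_top_iff]
    rintro x -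
    obtain ⟨y, hy, hxy⟩ := hle (Algebra.mem_top (x := F x))
    exact hF hxy ▸ hy

/-- The skew signs affect only the product: as a linear map `skewOf` is the ordinary tensor product
`f ⊗ g`, and over a field a tensor product of injections is injective. -/
theorem skewOf_injective {Γ Λ : DiffAlg} {A H : Type*} [Ring A] [Algebra ℂ A] [Ring H]
    [Algebra ℂ H] (f : A →ₐ[ℂ] Γ) (g : H →ₐ[ℂ] Λ) (hf : ∀ a, f a ∈ Γ.deg 0)
    (hg : ∀ h, g h ∈ Λ.deg 0) (hf' : Function.Injective f) (hg' : Function.Injective g) :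
    Function.Injective (skewOf f g hf hg) := by
  have h : ∀ x, skewOf f g hf hg x = GradedTensorProduct.of ℂ Γ.deg Λ.deg
      (TensorProduct.map f.toLinearMap g.toLinearMap x) := by
    intro x
    induction x using TensorProduct.induction_on with
    | zero => rw [map_zero, map_zero, map_zero]; rfl
    | tmul a h => exact (Algebra.TensorProduct.lift_tmul ..).trans (skewInl_mul_skewInr Γ Λ _ _)
    | add x y hx hy => rw [map_add, hx, hy, map_add, map_add]; rfl
  intro x y hxy
  rw [h, h] at hxy
  exact TensorProduct.map_injective_of_flat_flat _ _ hf' hg'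
    ((GradedTensorProduct.of ℂ Γ.deg Λ.deg).injective hxy)

end DiffAlg

/-- Over a field, a jointly injective finite family of linear maps stays jointly injective after
tensoring with a vector space. -/
theorem TensorProduct.eq_zero_of_forall_rTensor_eq_zero {k I M N : Type*} [Field k] [Finite I]
    [AddCommGroup M] [Module k M] [AddCommGroup N] [Module k N] {Q : I → Type*}
    [∀ i, AddCommGroup (Q i)] [∀ i, Module k (Q i)] (f : ∀ i, M →ₗ[k] Q i)
    (hf : ∀ x, (∀ i, f i x = 0) → x = 0) (t : M ⊗[k] N) (ht : ∀ i, (f i).rTensor N t = 0) :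
    t = 0 := by
  classical
  have := Fintype.ofFinite I
  -- Joint injectivity is injectivity of the single map into the product of the `Q i`. Flatness
  -- preserves it, and because `I` is finite the tensor product distributes over the product.
  have hinj : Function.Injective (LinearMap.pi f) := by
    rw [injective_iff_map_eq_zero]
    exact fun x hx => hf x fun i => congrFun hx i
  have h := Module.Flat.rTensor_preserves_injective_linearMap (M := N) _ hinj
  apply h
  rw [map_zero]
  apply (TensorProduct.piLeft k N Q).injective
  rw [map_zero]
  funext i
  refine Eq.trans ?_ (ht i)
  clear ht
  induction t using TensorProduct.induction_on with
  | zero => simp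
  | tmul x y => simp
  | add x y hx hy => rw [map_add, map_add, Pi.add_apply, map_add, hx, hy]

/-! ### Pull-back of forms from the base to the bundle, and compatibility on overlaps -/

namespace QPFB

open DiffAlg

variable {I : Type*} {B H P : Type*} [Ring B] [Algebra ℂ B] [Ring H] [HopfAlgebra ℂ H]
  [Ring P] [Algebra ℂ P] {J : I → Ideal B} [∀ i, (J i).IsTwoSided] (E : QPFB B H P J)
  (Γ : ∀ i, Calculus (B ⧸ J i)) (ΓH : Calculus H)

/-- The extension `Ω(B) → Γ(Bᵢ)` of the projection `B → Bᵢ`. -/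
def baseΩ (_ : QPFB B H P J) (i : I) : Hom (omega B) (Γ i).toDiffAlg :=
  (Γ i).ofOmega.comp (omegaMap (Ideal.Quotient.mkₐ ℂ (J i)))

theorem baseΩ_of (i : I) (b : B) :
    E.baseΩ Γ i (omegaIn B b) = (Γ i).of (Ideal.Quotient.mk (J i) b) := by
  rw [baseΩ, Hom.comp_apply, omegaMap_of, Calculus.ofOmega, omegaLift_of]
  rfl

theorem baseΩ_surjective (i : I) : Function.Surjective (E.baseΩ Γ i) :=
  (Γ i).ofOmega_surjective.comp (omegaMap_surjective _ (Ideal.Quotient.mkₐ_surjective ℂ (J i)))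

/-- The extension `Ω(B) → Γ(P)` of the embedding `ι : B → P`. -/
def ιΩ : Hom (omega B) (E.ΓP Γ ΓH) := (E.toΓP Γ ΓH).comp (omegaMap E.ι)

theorem ιΩ_of (b : B) : E.ιΩ Γ ΓH (omegaIn B b) = E.ofP Γ ΓH (E.ι b) := by
  rw [ιΩ, Hom.comp_apply, omegaMap_of]
  rfl

/-- Homomorphisms of differential algebras out of `Ω(B)` are determined on `B`, and there the
identity is the triviality condition `χᵢ(ι(b)) = πᵢ(b) ⊗ 1`. -/
theorem χΓ_ιΩ (i : I) (u : omega B) :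
    E.χΓ Γ ΓH i (E.ιΩ Γ ΓH u) = E.trivInl Γ ΓH i (E.baseΩ Γ i u) :=
  omega_hom_ext (f := (E.χΓ Γ ΓH i).comp (E.ιΩ Γ ΓH))
    (g := (E.trivInl Γ ΓH i).comp (E.baseΩ Γ i))
    (fun b => by
      rw [Hom.comp_apply, ιΩ_of, Hom.comp_apply, baseΩ_of, χΓ_ofP, χ_ι, trivOf_inl]) u

/-- Since `J_m(Bᵢⱼ)` is the kernel of `overlapΩ`, this moves membership in it from the overlap
algebra to `Γ(P)`, where the ideals `ker χᵢ_Γ` and `ker χⱼ_Γ` live side by side. -/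
theorem overlapΩ_eq (i j : I) (u : omega B) :
    E.overlapΩ Γ ΓH i j (omegaMap (Ideal.Quotient.mkₐ ℂ (J i ⊔ J j)) u) =
      E.toOverlap Γ ΓH i j (E.χΓ Γ ΓH i (E.ιΩ Γ ΓH u)) :=
  omega_hom_ext (f := (E.overlapΩ Γ ΓH i j).comp (omegaMap (Ideal.Quotient.mkₐ ℂ (J i ⊔ J j))))
    (g := (E.toOverlap Γ ΓH i j).comp ((E.χΓ Γ ΓH i).comp (E.ιΩ Γ ΓH)))
    (fun b => by
      rw [Hom.comp_apply, omegaMap_of]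
      refine (E.overlapΩ_of Γ ΓH i j b).trans ?_
      rw [Hom.comp_apply, Hom.comp_apply, ιΩ_of, χΓ_ofP, χ_ι]) u

/-- Together with `πmR_baseΩ`: on lifts to `Ω(B)` both restrictions become one and the same map to
`Γ_m(Bᵢⱼ)`, so the comparison of two forms depends only on the difference of their lifts. -/
theorem πmL_baseΩ (i j : I) (u : omega B) :
    E.πmL Γ ΓH i j (E.baseΩ Γ i u) =
      E.toΓmBij Γ ΓH i j (omegaMap (Ideal.Quotient.mkₐ ℂ (J i ⊔ J j)) u) :=
  omega_hom_ext (f := (E.πmL Γ ΓH i j).comp (E.baseΩ Γ i))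
    (g := (E.toΓmBij Γ ΓH i j).comp (omegaMap (Ideal.Quotient.mkₐ ℂ (J i ⊔ J j))))
    (fun b => by
      rw [Hom.comp_apply, Hom.comp_apply, baseΩ_of, πmL_of, omegaMap_of]
      rfl) u

theorem πmR_baseΩ (i j : I) (u : omega B) :
    E.πmR Γ ΓH i j (E.baseΩ Γ j u) =
      E.toΓmBij Γ ΓH i j (omegaMap (Ideal.Quotient.mkₐ ℂ (J i ⊔ J j)) u) :=
  omega_hom_ext (f := (E.πmR Γ ΓH i j).comp (E.baseΩ Γ j))
    (g := (E.toΓmBij Γ ΓH i j).comp (omegaMap (Ideal.Quotient.mkₐ ℂ (J i ⊔ J j))))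
    (fun b => by
      rw [Hom.comp_apply, Hom.comp_apply, baseΩ_of, πmR_of, omegaMap_of]
      rfl) u

/-- Two forms on the base agree on the overlap, with respect to `Γ_m(Bᵢⱼ)`, if and only if their
pull-backs to the bundle agree modulo `ker χᵢ_Γ + ker χⱼ_Γ`. -/
theorem πm_baseΩ_eq_iff (i j : I) (u v : omega B) :
    E.πmL Γ ΓH i j (E.baseΩ Γ i u) = E.πmR Γ ΓH i j (E.baseΩ Γ j v) ↔
      E.ιΩ Γ ΓH u - E.ιΩ Γ ΓH v ∈
        ((DiffIdeal.ker (E.χΓ Γ ΓH i)).sup (DiffIdeal.ker (E.χΓ Γ ΓH j))).ideal := by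
  rw [πmL_baseΩ, πmR_baseΩ, ← sub_eq_zero, ← map_sub, ← map_sub, ← map_sub]
  have h1 : ∀ w, E.toΓmBij Γ ΓH i j (omegaMap (Ideal.Quotient.mkₐ ℂ (J i ⊔ J j)) w) = 0 ↔
      E.toOverlap Γ ΓH i j (E.χΓ Γ ΓH i (E.ιΩ Γ ΓH w)) = 0 := fun w => by
    rw [← overlapΩ_eq]
    exact DiffIdeal.toQuot_eq_zero _ _
  rw [h1]
  -- Vanishing in `Γⁱ(Bᵢⱼ ⊗ H)` means that `χᵢ_Γ` of the pull-back of `u - v` equals `χᵢ_Γ(y)` for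
  -- some `y ∈ ker χⱼ_Γ`. The remainder after subtracting `y` is then in `ker χᵢ_Γ`.
  refine (DiffIdeal.toQuot_eq_zero _ _).trans
    ((Ideal.mem_map_iff_of_surjective (E.χΓ Γ ΓH i).toAlgHom (E.χΓ_surjective Γ ΓH i)).trans ?_)
  refine Iff.trans ?_ Submodule.mem_sup.symm
  constructor
  · rintro ⟨y, hy, hyu⟩
    refine ⟨E.ιΩ Γ ΓH (u - v) - y, ?_, y, hy, sub_add_cancel _ _⟩
    change E.χΓ Γ ΓH i _ = 0
    rw [map_sub, sub_eq_zero]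
    exact hyu.symm
  · rintro ⟨x, hx, y, hy, hxy⟩
    refine ⟨y, hy, ?_⟩
    change E.χΓ Γ ΓH i y = _
    have hx : E.χΓ Γ ΓH i x = 0 := hx
    rw [← hxy, map_add, hx, zero_add]

/-! ### Degree zero: from `Γ(P)` back to `P` -/

theorem trivOf_injective (i : I) : Function.Injective (E.trivOf Γ ΓH i) :=
  skewOf_injective _ _ _ _ (Γ i).isCalculus.injective ΓH.isCalculus.injective

theorem exists_ofP_eq {y : E.ΓP Γ ΓH} (hy : y ∈ (E.ΓP Γ ΓH).deg 0) : ∃ p, E.ofP Γ ΓH p = y := by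
  obtain ⟨x, hx, rfl⟩ := hy
  obtain ⟨p, rfl⟩ := exists_omegaOf_eq_of_mem_omegaDeg_zero P hx
  exact ⟨p, rfl⟩

/-- The kernels are graded, so a decomposition in `Γ(P)` of an element of degree zero may be
replaced by its degree zero components. These come from `P`, and injectivity of `trivOf` shows that
their representatives lie in `ker χᵢ` and `ker χⱼ`. -/
theorem mem_ker_sup_ker_of_ofP_mem {i j : I} {p : P}
    (hp : E.ofP Γ ΓH p ∈
      ((DiffIdeal.ker (E.χΓ Γ ΓH i)).sup (DiffIdeal.ker (E.χΓ Γ ΓH j))).ideal) :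
    p ∈ RingHom.ker (E.χ i) ⊔ RingHom.ker (E.χ j) := by
  obtain ⟨x, hx, y, hy, hxy⟩ := Submodule.mem_sup.mp hp
  have hdeg : E.ofP Γ ΓH p ∈ (E.ΓP Γ ΓH).deg 0 := ⟨omegaIn P p, omegaOf_mem p, rfl⟩
  have key : ∀ k z, E.χΓ Γ ΓH k z = 0 → ∃ r, E.χ k r = 0 ∧
      E.ofP Γ ΓH r = (E.ΓP Γ ΓH).proj 0 z := by
    intro k z hz
    obtain ⟨r, hr⟩ := E.exists_ofP_eq Γ ΓH ((E.ΓP Γ ΓH).proj_mem 0 z)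
    refine ⟨r, E.trivOf_injective Γ ΓH k ?_, hr⟩
    rw [← χΓ_ofP, hr, Hom.map_proj, hz, map_zero, map_zero]
  obtain ⟨r, hr, hrx⟩ := key i x hx
  obtain ⟨s, hs, hsy⟩ := key j y hy
  -- The elements `p - r` and `s` are compared only in `Γ(P)`. That suffices: `χⱼ_Γ` transfers the
  -- vanishing of `χⱼ(s)` to `χⱼ(p - r)`, so `p = r + (p - r)` is the required decomposition.
  have h : E.ofP Γ ΓH (p - r) = E.ofP Γ ΓH s := by
    have := congrArg ((E.ΓP Γ ΓH).proj 0) hxy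
    rw [map_add, (E.ΓP Γ ΓH).proj_of_mem 0 0 _ hdeg, if_pos rfl, ← hrx, ← hsy] at this
    rw [map_sub, ← this, add_sub_cancel_left]
  have hj : E.χ j (p - r) = 0 := by
    apply E.trivOf_injective Γ ΓH j
    rw [← χΓ_ofP, h, χΓ_ofP, hs]
  exact Submodule.mem_sup.mpr ⟨r, hr, p - r, hj, add_sub_cancel _ _⟩

/-- Every generator of `Γ(Bᵢ)` comes from `B`, so any differential algebra over `B` with a
homomorphism to `Γ(Bᵢ)` extending `πᵢ` surjects onto `Γ(Bᵢ)`. -/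
theorem adjoin_of_mk (i : I) : Algebra.adjoin ℂ
    (Set.range (fun b => (Γ i).of (Ideal.Quotient.mk (J i) b)) ∪
      Set.range fun b => (Γ i).d ((Γ i).of (Ideal.Quotient.mk (J i) b))) = ⊤ := by
  have hs : Function.Surjective (Ideal.Quotient.mk (J i)) := Ideal.Quotient.mk_surjective
  have h1 : (Set.range fun b => (Γ i).of (Ideal.Quotient.mk (J i) b)) = Set.range (Γ i).of :=
    hs.range_comp _
  have h2 : (Set.range fun b => (Γ i).d ((Γ i).of (Ideal.Quotient.mk (J i) b))) =
      Set.range fun b => (Γ i).d ((Γ i).of b) :=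
    hs.range_comp fun b => (Γ i).d ((Γ i).of b)
  rw [h1, h2]
  exact (Γ i).isCalculus.generated

/-- The inverse `Γ(Bᵢ) ⊗̂ Γ(H) → Γ(P)/ker χᵢ_Γ` of the isomorphism induced by `χᵢ_Γ`. -/
def trivToQuot (i : I) : Hom (E.trivCalc Γ ΓH i) (DiffIdeal.ker (E.χΓ Γ ΓH i)).quot :=
  (E.χΓ Γ ΓH i).factor (E.χΓ_surjective Γ ΓH i) (DiffIdeal.ker (E.χΓ Γ ΓH i)).toQuot
    fun x hx => (DiffIdeal.toQuot_eq_zero _ x).mpr hx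

theorem trivToQuot_χΓ (i : I) (y : E.ΓP Γ ΓH) :
    E.trivToQuot Γ ΓH i (E.χΓ Γ ΓH i y) = (DiffIdeal.ker (E.χΓ Γ ΓH i)).toQuot y :=
  Hom.factor_apply _ _ _ _ _

/-! ### Gluing functions: `Γ_m(B)` is a differential algebra over `B` -/

section Finite

variable [Finite I]

/-- Each `χᵢ` turns the coaction into `id ⊗ Δ`, for which `bᵢ ⊗ 1` is coinvariant. The `χᵢ` are
jointly injective, and remain so after tensoring with `H`, hence coinvariance can be checked
locally. -/
theorem coaction_eq_of_χ_eq {p : P} (b : ∀ i, B ⧸ J i) (hp : ∀ i, E.χ i p = b i ⊗ₜ 1) :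
    E.coaction p = p ⊗ₜ 1 := by
  rw [← sub_eq_zero]
  refine TensorProduct.eq_zero_of_forall_rTensor_eq_zero (fun i => (E.χ i).toLinearMap) ?_ _ ?_
  · intro x hx
    have : x ∈ ⨅ i, RingHom.ker (E.χ i) := (Submodule.mem_iInf _).mpr hx
    rwa [E.total_covering.iInf_eq_bot] at this
  · intro i
    rw [map_sub, sub_eq_zero]
    have h := DFunLike.congr_fun (E.χ_coaction i) p
    -- The covariance of `χᵢ` is stated in `Bᵢ ⊗ (H ⊗ H)`, whereas the goal lives in `(Bᵢ ⊗ H) ⊗ H`.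
    apply (Algebra.TensorProduct.assoc ℂ ℂ ℂ (B ⧸ J i) H H).injective
    refine h.symm.trans ?_
    change Algebra.TensorProduct.map (AlgHom.id ℂ (B ⧸ J i)) (Bialgebra.comulAlgHom ℂ H)
      (E.χ i p) = Algebra.TensorProduct.assoc ℂ ℂ ℂ (B ⧸ J i) H H (E.χ i p ⊗ₜ 1)
    rw [hp, Algebra.TensorProduct.map_tmul, map_one]
    rfl

/-- A family of elements of the `Bᵢ` whose pull-backs to the bundle are compatible comes from a
global element of `B`. -/
theorem exists_glue (b : I → B)
    (hb : ∀ i j, E.ι (b i) - E.ι (b j) ∈ RingHom.ker (E.χ i) ⊔ RingHom.ker (E.χ j)) :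
    ∃ a : B, ∀ i, Ideal.Quotient.mk (J i) a = Ideal.Quotient.mk (J i) (b i) := by
  obtain ⟨p, hp⟩ := E.total_covering.complete (fun i => Submodule.Quotient.mk (E.ι (b i)))
    fun i j => (Submodule.Quotient.eq _).mpr (hb i j)
  have hχ : ∀ i, E.χ i p = Ideal.Quotient.mk (J i) (b i) ⊗ₜ 1 := fun i => by
    have h : E.χ i (E.ι (b i) - p) = 0 := (Submodule.Quotient.eq _).mp (hp i)
    rw [← E.χ_ι, ← sub_eq_zero, ← neg_eq_zero, ← map_sub, ← map_neg, neg_sub]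
    exact h
  obtain ⟨a, rfl⟩ := (E.range_ι p).mpr (E.coaction_eq_of_χ_eq _ hχ)
  refine ⟨a, fun i => ?_⟩
  have h := (E.χ_ι i a).symm.trans (hχ i)
  -- The map `id ⊗ ε` recovers `b` from `b ⊗ 1`, because `ε(1) = 1`.
  simpa using congrArg ((Algebra.TensorProduct.rid ℂ ℂ (B ⧸ J i)).toAlgHom.comp
    (Algebra.TensorProduct.map (AlgHom.id ℂ (B ⧸ J i)) (Bialgebra.counitAlgHom ℂ H))) h

/-- The substance is that no compatible family of functions lies outside `B`. Compatibility is
imposed in `Γ_m(Bᵢⱼ)`, so the family is glued in `P` and then descended to `B` by coinvariance. -/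
theorem isOver_Γm : IsOver (E.Γm Γ ΓH) (E.ofΓm Γ ΓH) where
  injective := by
    rw [injective_iff_map_eq_zero]
    intro b hb
    have : b ∈ ⨅ i, J i := (Submodule.mem_iInf _).mpr fun i => by
      rw [← Ideal.Quotient.eq_zero_iff_mem]
      apply (Γ i).isCalculus.injective
      rw [map_zero]
      exact congrFun (congrArg Subtype.val hb) i
    rwa [E.base_covering.iInf_eq_bot] at this
  range_eq x := by
    constructor
    · intro hx
      have h : ∀ i, ∃ b : B, (Γ i).of (Ideal.Quotient.mk (J i) b) = x.1 i := fun i => by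
        obtain ⟨b, hb⟩ := ((Γ i).isCalculus.range_eq _).mp (hx i)
        obtain ⟨b, rfl⟩ := Ideal.Quotient.mk_surjective b
        exact ⟨b, hb⟩
      choose b hb using h
      obtain ⟨a, ha⟩ := E.exists_glue b fun i j => by
        have h := x.2 i j
        -- Each `bᵢ` is regarded as a form of degree zero in `Ω(B)`, so that the gluing condition of
        -- `Γ_m(B)` becomes a membership in `ker χᵢ_Γ + ker χⱼ_Γ`.
        rw [← hb, ← hb, ← baseΩ_of E, ← baseΩ_of E, πm_baseΩ_eq_iff, ιΩ_of, ιΩ_of, ← map_sub] at h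
        exact E.mem_ker_sup_ker_of_ofP_mem Γ ΓH h
      refine ⟨a, Subtype.ext (funext fun i => ?_)⟩
      rw [← hb, ← ha]
      rfl
    · rintro ⟨b, rfl⟩ i
      exact (Γ i).of_mem _

/-! ### The covering of `Γ_m(B)` by the kernels of the coordinate projections -/

theorem πm_surjective (i : I) : Function.Surjective (E.πm Γ ΓH i) := by
  rw [← AlgHom.range_eq_top, eq_top_iff, ← adjoin_of_mk, Algebra.adjoin_le_iff]
  rintro _ (⟨b, rfl⟩ | ⟨b, rfl⟩)
  · exact ⟨E.ofΓm Γ ΓH b, rfl⟩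
  · exact ⟨(E.Γm Γ ΓH).d (E.ofΓm Γ ΓH b), rfl⟩

theorem isLC_Γm (hJ : ∀ i, J i ≠ ⊥) :
    IsLC (E.Γm Γ ΓH) (E.ofΓm Γ ΓH) fun i => DiffIdeal.ker (E.πm Γ ΓH i) where
  isOver := E.isOver_Γm Γ ΓH
  covering := by
    rw [eq_bot_iff]
    intro x hx
    rw [Submodule.mem_iInf] at hx
    exact gluing_ext fun i => (hx i).trans (map_zero _).symm
  calculus i := isCalculus_quot_ker (E.isOver_Γm Γ ΓH) _ (adjoin_of_mk Γ i)
  -- The degree zero part of the `i`-th kernel contains `Jᵢ`, which is nonzero.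
  degZero_ne_bot i h := hJ i <| by
    rw [eq_bot_iff, ← h]
    intro b hb
    change (Γ i).of (Ideal.Quotient.mk (J i) b) = 0
    rw [Ideal.Quotient.eq_zero_iff_mem.mpr hb, map_zero]

/-! ### The embedding into `Γ_c(P)` and maximality -/

theorem χΓc_eq_of_completionProj_eq {i : I} {x : E.ΓcP Γ ΓH} {y : E.ΓP Γ ΓH}
    (h : completionProj (E.ΓP Γ ΓH) (fun i => DiffIdeal.ker (E.χΓ Γ ΓH i)) i x =
      (DiffIdeal.ker (E.χΓ Γ ΓH i)).toQuot y) :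
    E.χΓc Γ ΓH i x = E.χΓ Γ ΓH i y :=
  congrArg ((DiffIdeal.ker (E.χΓ Γ ΓH i)).lift (E.χΓ Γ ΓH i) fun _ hx => hx).toAlgHom h

/-- The homomorphism `Γ_m(B) → Γ_c(P)` extending `ι`. -/
def ιm : Hom (E.Γm Γ ΓH) (E.ΓcP Γ ΓH) :=
  gluingLift (fun i => (E.trivToQuot Γ ΓH i).comp ((E.trivInl Γ ΓH i).comp (E.πm Γ ΓH i)))
    fun i j x => by
      -- With lifts `u`, `v` of the two coordinates, the `i`-th and `j`-th components in `Γ_c(P)`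
      -- are the classes of `ιΩ u` and `ιΩ v`. Their agreement modulo `ker χᵢ_Γ + ker χⱼ_Γ` is the
      -- gluing condition of `Γ_m(B)` in the form of `πm_baseΩ_eq_iff`.
      obtain ⟨u, hu⟩ := E.baseΩ_surjective Γ i (x.1 i)
      obtain ⟨v, hv⟩ := E.baseΩ_surjective Γ j (x.1 j)
      have h := x.2 i j
      rw [← hu, ← hv, πm_baseΩ_eq_iff] at h
      have hu : E.πm Γ ΓH i x = E.baseΩ Γ i u := hu.symm
      have hv : E.πm Γ ΓH j x = E.baseΩ Γ j v := hv.symm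
      simp only [Hom.comp_apply]
      rw [hu, hv, ← χΓ_ιΩ, ← χΓ_ιΩ, trivToQuot_χΓ, trivToQuot_χΓ, DiffIdeal.lift_toQuot,
        DiffIdeal.lift_toQuot, toQuot_eq_iff]
      exact h

theorem completionProj_ιm (i : I) (γ : E.Γm Γ ΓH) :
    completionProj (E.ΓP Γ ΓH) (fun i => DiffIdeal.ker (E.χΓ Γ ΓH i)) i (E.ιm Γ ΓH γ) =
      E.trivToQuot Γ ΓH i (E.trivInl Γ ΓH i (E.πm Γ ΓH i γ)) := rfl

theorem isEmbeddable_Γm (hJ : ∀ i, J i ≠ ⊥) :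
    E.IsEmbeddable Γ ΓH (E.Γm Γ ΓH) (E.ofΓm Γ ΓH) (E.πm Γ ΓH) where
  isLC := E.isLC_Γm Γ ΓH hJ
  π_surjective := E.πm_surjective Γ ΓH
  π_of _ _ := rfl
  embedding := by
    refine ⟨E.ιm Γ ΓH, fun b => Subtype.ext (funext fun i => ?_), fun i γ => ?_⟩
    · refine (E.completionProj_ιm Γ ΓH i _).trans ?_
      have h : E.πm Γ ΓH i (E.ofΓm Γ ΓH b) = (Γ i).of (Ideal.Quotient.mk (J i) b) := rfl
      rw [h, ← trivOf_inl, ← E.χ_ι, ← χΓ_ofP, trivToQuot_χΓ]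
      rfl
    · obtain ⟨y, hy⟩ := E.χΓ_surjective Γ ΓH i (E.trivInl Γ ΓH i (E.πm Γ ΓH i γ))
      rw [← hy]
      apply χΓc_eq_of_completionProj_eq
      rw [completionProj_ιm, ← hy, trivToQuot_χΓ]

/-- This is maximality. The condition `χᵢ_{Γ_c}(ι_Γg(γ)) = πᵢ(γ) ⊗̂ 1` forces the `i`-th component
of `ι_Γg(γ)` to be the class of the pull-back of any lift of `πᵢ(γ)`. Since `ι_Γg(γ)` lies in the
covering completion, these classes match on overlaps, and `πm_baseΩ_eq_iff` turns this into the
condition defining `Γ_m(B)`. -/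
theorem πm_compatible_of_isEmbeddable {Γg : DiffAlg} {of : B →ₐ[ℂ] Γg}
    {π : ∀ i, Hom Γg (Γ i).toDiffAlg} (h : E.IsEmbeddable Γ ΓH Γg of π) (i j : I) (γ : Γg) :
    E.πmL Γ ΓH i j (π i γ) = E.πmR Γ ΓH i j (π j γ) := by
  obtain ⟨ιg, -, hιg⟩ := h.embedding
  have key : ∀ k, ∃ u, E.baseΩ Γ k u = π k γ ∧
      completionProj (E.ΓP Γ ΓH) (fun i => DiffIdeal.ker (E.χΓ Γ ΓH i)) k (ιg γ) =
        (DiffIdeal.ker (E.χΓ Γ ΓH k)).toQuot (E.ιΩ Γ ΓH u) := fun k => by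
    obtain ⟨u, hu⟩ := E.baseΩ_surjective Γ k (π k γ)
    refine ⟨u, hu, ?_⟩
    have hk := hιg k γ
    obtain ⟨y, hy⟩ := DiffIdeal.toQuot_surjective _
      (completionProj (E.ΓP Γ ΓH) (fun i => DiffIdeal.ker (E.χΓ Γ ΓH i)) k (ιg γ))
    -- For a representative `y` of the component, embeddability now says that `y` and `ιΩ u` have
    -- the same image under `χₖ_Γ`, so they define the same class modulo its kernel.
    rw [← hu, ← χΓ_ιΩ, E.χΓc_eq_of_completionProj_eq Γ ΓH hy.symm] at hk
    rw [← hy, toQuot_eq_iff]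
    change E.χΓ Γ ΓH k _ = 0
    rw [map_sub, hk, sub_self]
  obtain ⟨u, hu, hu'⟩ := key i
  obtain ⟨v, hv, hv'⟩ := key j
  rw [← hu, ← hv, πm_baseΩ_eq_iff, ← toQuot_eq_iff]
  have hc := (ιg γ).2 i j
  have hu'' : (ιg γ).1 i = _ := hu'
  have hv'' : (ιg γ).1 j = _ := hv'
  rw [hu'', hv''] at hc
  exact hc

end Finite

end QPFB

end

theorem proposition9 {I : Type*} [Finite I] {B H P : Type*} [Ring B] [Algebra ℂ B]
    [Ring H] [HopfAlgebra ℂ H] [Ring P] [Algebra ℂ P]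
    (J : I → Ideal B) [∀ i, (J i).IsTwoSided] (hJ : ∀ i, J i ≠ ⊥) (E : QPFB B H P J)
    (Γ : ∀ i, Calculus (B ⧸ J i)) (ΓH : Calculus H) (hΓH : ΓH.IsRightCovariant) :
    E.IsEmbeddable Γ ΓH (E.Γm Γ ΓH) (E.ofΓm Γ ΓH) (E.πm Γ ΓH) ∧
    ∀ (Γg : DiffAlg) (of : B →ₐ[ℂ] Γg) (π : ∀ i, DiffAlg.Hom Γg (Γ i).toDiffAlg),
      E.IsEmbeddable Γ ΓH Γg of π →
      ∃ f : DiffAlg.Hom Γg (E.Γm Γ ΓH), Function.Injective f ∧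
        (∀ b, f (of b) = E.ofΓm Γ ΓH b) ∧
        ∀ i γ, E.πm Γ ΓH i (f γ) = π i γ := by
  refine ⟨E.isEmbeddable_Γm Γ ΓH hJ, fun Γg of π h => ⟨DiffAlg.gluingLift π
    (E.πm_compatible_of_isEmbeddable Γ ΓH h), ?_, fun b => DiffAlg.gluing_ext (h.π_of · b),
    fun _ _ => rfl⟩⟩
  -- An element with all projections zero lies in every covering ideal of `Γg`, and these intersect
  -- in zero.
  rw [injective_iff_map_eq_zero]
  intro γ hγ
  have hmem : γ ∈ ⨅ i, (DiffAlg.DiffIdeal.ker (π i)).ideal :=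
    (Submodule.mem_iInf _).mpr fun i => congrFun (congrArg Subtype.val hγ) i
  rwa [h.isLC.covering] at hmem
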